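/- **Languages and algebras.** An LE-language $\mathcal L=\mathcal L_{LE}(\mathcal F,\mathcal G)$ has $\wedge,\vee,\top,\bot$ and connectives $h\in\mathcal F\uplus\mathcal G$, each with an arity $n_h$ and an order type $\varepsilon_h\in\{1,\partial\}^{n_h}$. A *perfect* $\mathcal L$-algebra (perfect LE) is a complete lattice $\mathbb A$ that is completely join-generated by the set $J^\infty(\mathbb A)$ of its completely join-irreducible elements and completely meet-generated by the set $M^\infty(\mathbb A)$ of its completely meet-irreducible elements, in which every $f\in\mathcal F$ turns, coordinatewise, arbitrary joins of $\mathbb A^{\varepsilon_f(i)}$ into joins, and every $g\in\mathcal G$ turns arbitrary meets of $\mathbb A^{\varepsilon_g(i)}$ into meets. The fully residuated language $\mathcal L^*$ adds to $\mathcal L$ a residual of every $h$ in every coordinate $i$. The residual of $f\in\mathcal F$ in coordinate $i$ is in $\mathcal G^*$ if $\varepsilon_f(i)=1$ and in $\mathcal F^*$ otherwise; dually, the residual of $g\in\mathcal G$ is in $\mathcal F^*$ if $\varepsilon_g(i)=1$ and in $\mathcal G^*$ otherwise. Residuals are interpreted in every perfect LE by the adjunction. **Trees.** To an inequality $s\le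 t$ belong the signed generation trees $+s$, $-t$; signs pass unchanged through $\wedge,\vee$ and positive coordinates and are reversed in negative coordinates. Nodes $+f,-g$ are *definite skeleton* nodes, $+g,-f$ *definite PIA* nodes ($f\in\mathcal F^*$, $g\in\mathcal G^*$). Nodes $+\vee,-\wedge$ are also skeleton nodes. A positive (negative) skeleton is a term $s$ such that $+s$ ($-s$) has only skeleton nodes and leaves; it is *definite* if only definite skeleton nodes are used; $\top,\bot$ are allowed as leaves. For $\varepsilon$ assigning $1$ or $\partial$ to each variable, a leaf $+x$ with $\varepsilon(x)=1$ or $-x$ with $\varepsilon(x)=\partial$ is *critical*; the other variable leaves are *non-critical*. A variable is *uniform* if all its occurrences have the same sign. $\Omega$ denotes a strict partial order on variables. An $\mathcal L$-inequality is *inductive* if no variable in it is uniform and for some $\varepsilon,\Omega$ every critical branch consists, from the root, of definite skeleton nodes, then $+\wedge,-\vee$ nodes, then definite PIA nodes (each part possibly empty), and for every non-unary definite PIA node on the branch to a critical leaf labelled $x$, that leaf is the only critical leaf below the node, and every variable $y\ne x$ below the node satisfies $y<_\Omega x$. **Very simple Sahlqvist.** $s\le t$ is very simple $\varepsilon$-Sahlqvist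 if above each critical leaf there are only definite skeleton nodes. In the variant *with meets*, $+\wedge,-\vee$ nodes are also allowed between the definite skeleton nodes and the critical leaf. The theorem below holds with either reading, used throughout. **Crypto-inductive.** In the tree of an $\mathcal L^*$-inequality, an $\mathcal L^*$-connective node is *residuation-conservative* in coordinate $k$ if its residual in that coordinate is in $\mathcal L$ (i.e. the node is the residual in coordinate $k$ of a connective of $\mathcal L$). Given $\varepsilon,\Omega$, for a non-critical leaf $l$ labelled $x$, $\mathrm{MVTree}(l)$ is the largest subtree (given by its root) containing $l$ such that: the path from its root to $l$ consists of $-f$ ($f\in\mathcal F^*$) and $+g$ ($g\in\mathcal G^*$) nodes that are residuation-conservative in the coordinate containing $l$; no variable $\Omega$-larger than $x$ and no critical leaf occurs in it; its root does not carry a connective of $\mathcal L$; and its root does not lie on the path from the root of $\mathrm{MVTree}(l')$ to $l'$ for any non-critical leaf $l'$ to the left of $l$. (The trees are determined from left to right; $\{l\}$ itself is always eligible.) The inequality satisfies the *crypto-inductivity conditions* for $\varepsilon,\Omega$ if it is very simple $\varepsilon$-Sahlqvist; all connectives on critical branches are in $\mathcal L$; every occurrence of a connective outside $\mathcal L$ lies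 on the path from the root of $\mathrm{MVTree}(l)$ to $l$ for some non-critical leaf $l$; and among the variables in the scope of every such occurrence there is an $\Omega$-greatest one. It is *crypto $\mathcal L$-inductive* if it satisfies these conditions for some $\varepsilon,\Omega$ and no variable in it is uniform. **Formulas.** Consider first-order formulas whose atoms are pure $\mathcal L^*$-inequalities (inequalities between $\mathcal L^*$-terms over nominals $\mathbf j$ and conominals $\mathbf m$). On a perfect LE, nominals range over $J^\infty(\mathbb A)$ and conominals over $M^\infty(\mathbb A)$; $s\nleq t$ is $\neg(s\le t)$. Fix a set $E$ of outer pure variables. Simultaneously define *positive* and *negative inverse disjuncts* $\theta$ with main variable $v$, together with their *compaction* $\xi$ (an $\mathcal L^*$-term): * $\mathbf j\le\psi$ with $\psi$ a negative skeleton, or $\varphi\le\mathbf m$ with $\varphi$ a positive skeleton, is positive with main variable $\mathbf j$, $\mathbf m$ and compaction $\psi$, $\varphi$; all variables of the skeleton are in $E$ and, in $-\psi$, resp. $+\varphi$, nominal leaves are negative and conominal leaves positive. * $\mathbf j\nleq\psi$, $\varphi\nleq\mathbf m$ are likewise negative, but in $-\psi$, resp. $+\varphi$, nominal leaves are positive and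 conominal leaves negative. * A conjunction of two positive (a disjunction of two negative) inverse disjuncts with the same main variable $v$ is again one; its compaction is $\xi_1\wedge\xi_2$ if $v$ is a nominal and $\xi_1\vee\xi_2$ if $v$ is a conominal. * Let $\psi(u_1,\dots,u_n)$, $n\ge1$, be a definite negative skeleton containing each of the distinct pure variables $u_i\notin E\cup\{\mathbf j\}$ exactly once and no other variable, such that in $-\psi$ the nominals are positive and the conominals negative. If $\theta_i$ are negative inverse disjuncts with main variables $u_i$ and compactions $\xi_i$ in which $\mathbf j$ does not occur, then $\forall\bar u(\mathbf j\nleq\psi\Rightarrow\theta_1\vee\dots\vee\theta_n)$ is a positive one; if $\theta_i$ are positive, then $\exists\bar u(\theta_1\wedge\dots\wedge\theta_n\wedge\mathbf j\nleq\psi)$ is a negative one; both have main variable $\mathbf j$ and compaction $\psi(\xi_1,\dots,\xi_n)$. Dually for a conominal $\mathbf m$ and $\varphi\nleq\mathbf m$ with $\varphi$ a definite positive skeleton and the signs taken in $+\varphi$. A *pre-inverse correspondent* is a closed formula $\forall u_1\cdots\forall u_n\,(\theta_{k_1}\vee\dots\vee\theta_{k_r}\vee\varphi\le\psi)$ or $\forall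 u_1\cdots\forall u_n\,(\neg\theta_{k_1}\wedge\dots\wedge\neg\theta_{k_r}\Rightarrow\varphi\le\psi)$, where: the $u_k$ are distinct pure variables; two sets of them, which together contain all of them and may overlap, are singled out, the *constrained* variables $u_{k_1},\dots,u_{k_r}$ and the *free* ones; $\theta_{k}$ is a negative inverse disjunct with main variable $u_k$, relative to $E=$ the set of free variables; $\varphi$ and $\psi$ are a definite positive and a definite negative skeleton, each $u_k$ occurs exactly once in $\varphi\le\psi$ and no other variable occurs, and in $+\varphi,-\psi$ nominals are positive and conominals negative. Its *associated $\mathcal L^*$-inequality* arises from $\varphi\le\psi$ by replacing each $u_k$ that is constrained and not free by its compaction $\xi_k$, each one that is both by $\xi_k\wedge u_k$ (nominal) or $\xi_k\vee u_k$ (conominal), leaving the others, and finally replacing distinct pure variables by distinct proposition variables. An *$\mathcal L$-inverse correspondent* is a pre-inverse correspondent whose associated inequality satisfies the crypto-inductivity conditions for some $\varepsilon,\Omega$. **Theorem.** Let $\chi$ be an $\mathcal L$-inverse correspondent. Then 1. there is a crypto $\mathcal L$-inductive inequality $s\le t$ of $\mathcal L^*$ such that, for every perfect $\mathcal L$-algebra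 $\mathbb A$, $\mathbb A\models\chi$ if and only if $\mathbb A\models s\le t$; 2. there is an inductive $\mathcal L$-inequality $s'\le t'$ such that, for every perfect $\mathcal L$-algebra $\mathbb A$, $\mathbb A\models\chi$ if and only if $\mathbb A\models s'\le t'$. -/

import Mathlib

/-!
Signs and order types are encoded by `Bool`: `true` is `+` (resp. `1`) and `false` is `-`
(resp. `∂`). The product of two signs is `σ == τ`.
-/

universe u v w

namespace InvCorr

/-! ### Languages and terms -/

/-- A lattice-expansion signature: connectives `Op = F ⊎ G` (`isF h` says that `h` lies in `F`,
otherwise it lies in `G`), each with an arity and an order type. -/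
structure LESig where
  Op : Type v
  isF : Op → Bool
  arity : Op → ℕ
  tp : (h : Op) → Fin (arity h) → Bool

/-- Connectives of the fully residuated language: the original ones, and for every connective `h`
and coordinate `i` a symbol `res h i` for the residual of `h` in that coordinate. -/
inductive StarOp (S : LESig.{v}) : Type v
  | base (h : S.Op) : StarOp S
  | res (h : S.Op) (i : Fin (S.arity h)) : StarOp S

namespace StarOp

variable {S : LESig.{v}}

/-- The residual of `f ∈ F` in a positive coordinate lies in `G*`, in a negative one in `F*`;
the residual of `g ∈ G` in a positive coordinate lies in `F*`, in a negative one in `G*`. -/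
def isF : StarOp S → Bool
  | base h => S.isF h
  | res h i => xor (S.isF h) (S.tp h i)

abbrev arity : StarOp S → ℕ
  | base h => S.arity h
  | res h _ => S.arity h

/-- `res h i` keeps the order type of `h` in coordinate `i`; in the other coordinates the order
type is reversed if `i` is a positive coordinate of `h`, and kept if `i` is negative. -/
def tp : (h : StarOp S) → Fin h.arity → Bool
  | base h => S.tp h
  | res h i => fun (k : Fin (S.arity h)) => if k = i then S.tp h i else xor (S.tp h i) (S.tp h k)

/-- The symbol belongs to the original language. -/
def IsBase : StarOp S → Prop
  | base _ => True
  | res _ _ => False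

/-- The residual of the connective in the `k`-th coordinate (coordinates are counted from `0`)
belongs to the original language. The residual of `res h i` in coordinate `i` is `h`; the
residuals of `base h`, and those of `res h i` in the coordinates `k ≠ i`, are (up to the order of
the arguments) the new symbols `res h k`. -/
def Conservative : StarOp S → ℕ → Prop
  | base _, _ => False
  | res _ i, k => k = i.val

end StarOp

/-- The fully residuated language of `S`. -/
abbrev LESig.star (S : LESig.{v}) : LESig.{v} where
  Op := StarOp S
  isF := StarOp.isF
  arity := StarOp.arity
  tp := StarOp.tp

/-- Terms (formulas) of the language `S` over the set `V` of variables. -/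
inductive Trm (S : LESig.{v}) (V : Type w) : Type (max v w)
  | var (x : V) : Trm S V
  | top : Trm S V
  | bot : Trm S V
  | inf (a b : Trm S V) : Trm S V
  | sup (a b : Trm S V) : Trm S V
  | op (h : S.Op) (args : Fin (S.arity h) → Trm S V) : Trm S V

namespace Trm

variable {S : LESig.{v}} {V W : Type}

/-- Simultaneous substitution. -/
def bind (f : V → Trm S W) : Trm S V → Trm S W
  | var x => f x
  | top => top
  | bot => bot
  | inf a b => inf (a.bind f) (b.bind f)
  | sup a b => sup (a.bind f) (b.bind f)
  | op h args => op h fun i => (args i).bind f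

/-- Renaming of variables. -/
def rename (f : V → W) (t : Trm S V) : Trm S W := t.bind fun x => var (f x)

/-- Number of occurrences of a variable. -/
def count [DecidableEq V] (x : V) : Trm S V → ℕ
  | var y => if y = x then 1 else 0
  | top => 0
  | bot => 0
  | inf a b => a.count x + b.count x
  | sup a b => a.count x + b.count x
  | op _ args => ∑ i, (args i).count x

/-- All variables of the term satisfy `E`. -/
def VarsIn (E : V → Prop) : Trm S V → Prop
  | var x => E x
  | top => True
  | bot => True
  | inf a b => a.VarsIn E ∧ b.VarsIn E
  | sup a b => a.VarsIn E ∧ b.VarsIn E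
  | op _ args => ∀ i, (args i).VarsIn E

/-- In the generation tree of the term with sign `σ` at the root, every leaf labelled by a
variable `x` has the sign `f x`. -/
def LeafSign (f : V → Bool) : Bool → Trm S V → Prop
  | σ, var x => σ = f x
  | _, top => True
  | _, bot => True
  | σ, inf a b => a.LeafSign f σ ∧ b.LeafSign f σ
  | σ, sup a b => a.LeafSign f σ ∧ b.LeafSign f σ
  | σ, op h args => ∀ i, (args i).LeafSign f (σ == S.tp h i)

/-- The generation tree with sign `σ` at the root consists only of skeleton nodes: `+f`, `-g`
and, unless `definite` is set, also `+∨`, `-∧`. So `Skel false true`, `Skel false false` are the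
positive and negative skeletons, `Skel true true`, `Skel true false` the definite ones. -/
def Skel (definite : Bool) : Bool → Trm S V → Prop
  | _, var _ => True
  | _, top => True
  | _, bot => True
  | σ, inf a b => σ = false ∧ definite = false ∧ a.Skel definite σ ∧ b.Skel definite σ
  | σ, sup a b => σ = true ∧ definite = false ∧ a.Skel definite σ ∧ b.Skel definite σ
  | σ, op h args => S.isF h = σ ∧ ∀ i, (args i).Skel definite (σ == S.tp h i)

/-- Value of a term, given the interpretation `I` of the connectives and an assignment. -/
def eval {A : Type u} [CompleteLattice A] (I : (h : S.Op) → (Fin (S.arity h) → A) → A)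
    (x : V → A) : Trm S V → A
  | var y => x y
  | top => ⊤
  | bot => ⊥
  | inf a b => a.eval I x ⊓ b.eval I x
  | sup a b => a.eval I x ⊔ b.eval I x
  | op h args => I h fun i => (args i).eval I x

/-- The `k`-th child of the root, with its sign relative to the root. -/
def child : Trm S V → ℕ → Option (Bool × Trm S V)
  | inf a b, k => if k = 0 then some (true, a) else if k = 1 then some (true, b) else none
  | sup a b, k => if k = 0 then some (true, a) else if k = 1 then some (true, b) else none
  | op h args, k =>
      if hk : k < S.arity h then some (S.tp h ⟨k, hk⟩, args ⟨k, hk⟩) else none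
  | _, _ => none

/-- The node at a position (a list of child numbers, read from the root) of the generation tree
with sign `σ` at the root: its sign and the subterm rooted there. -/
def nodeAt : Bool → Trm S V → List ℕ → Option (Bool × Trm S V)
  | σ, t, [] => some (σ, t)
  | σ, t, k :: p =>
      match t.child k with
      | some (τ, a) => nodeAt (σ == τ) a p
      | none => none

end Trm

/-! ### Perfect lattice expansions -/

/-- Completely join-irreducible elements. -/
def CJI {A : Type u} [CompleteLattice A] (j : A) : Prop := ∀ X : Set A, sSup X = j → j ∈ X

/-- Completely meet-irreducible elements. -/
def CMI {A : Type u} [CompleteLattice A] (m : A) : Prop := ∀ X : Set A, sInf X = m → m ∈ X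

/-- The join of `X` in the lattice (`σ = true`) or in its dual (`σ = false`). -/
def sgSup {A : Type u} [CompleteLattice A] (σ : Bool) (X : Set A) : A :=
  if σ = true then sSup X else sInf X

/-- Perfect (normal) lattice expansions of signature `S`. -/
structure PerfectLE (S : LESig.{v}) where
  carrier : Type u
  [lat : CompleteLattice carrier]
  join_gen : ∀ a : carrier, a = sSup {j | CJI j ∧ j ≤ a}
  meet_gen : ∀ a : carrier, a = sInf {m | CMI m ∧ a ≤ m}
  op : (h : S.Op) → (Fin (S.arity h) → carrier) → carrier
  map_F : ∀ (h : S.Op) (i : Fin (S.arity h)) (x : Fin (S.arity h) → carrier) (X : Set carrier),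
    S.isF h = true →
      op h (Function.update x i (sgSup (S.tp h i) X)) =
        sSup ((fun a => op h (Function.update x i a)) '' X)
  map_G : ∀ (h : S.Op) (i : Fin (S.arity h)) (x : Fin (S.arity h) → carrier) (X : Set carrier),
    S.isF h = false →
      op h (Function.update x i (sgSup (!(S.tp h i)) X)) =
        sInf ((fun a => op h (Function.update x i a)) '' X)

attribute [instance] PerfectLE.lat

namespace PerfectLE

variable {S : LESig.{v}}

/-- Interpretation of the fully residuated language. For `f ∈ F`, `res f i` is determined by
`f(x₁,…,a,…,xₙ) ≤ b ↔ a ≤^{ε(i)} (res f i)(x₁,…,b,…,xₙ)`, and for `g ∈ G`, `res g i` by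
`b ≤ g(x₁,…,a,…,xₙ) ↔ (res g i)(x₁,…,b,…,xₙ) ≤^{ε(i)} a`, with `a`, `b` in coordinate `i`. -/
def opStar (A : PerfectLE.{u} S) :
    (h : S.star.Op) → (Fin (S.star.arity h) → A.carrier) → A.carrier
  | .base h, x => A.op h x
  | .res h i, x =>
      if S.isF h = true then sgSup (S.tp h i) {a | A.op h (Function.update x i a) ≤ x i}
      else sgSup (!(S.tp h i)) {a | x i ≤ A.op h (Function.update x i a)}

/-- Validity of an inequality of the original language. -/
def Valid (A : PerfectLE.{u} S) (s t : Trm S ℕ) : Prop :=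
  ∀ x : ℕ → A.carrier, s.eval A.op x ≤ t.eval A.op x

/-- Validity of an inequality of the fully residuated language. -/
def ValidStar (A : PerfectLE.{u} S) (s t : Trm S.star ℕ) : Prop :=
  ∀ x : ℕ → A.carrier, s.eval A.opStar x ≤ t.eval A.opStar x

end PerfectLE

/-! ### Signed generation trees of inequalities, inductive inequalities -/

section Trees

variable {S : LESig.{v}}

/-- The node at a position of the pair of signed generation trees `+s`, `-t`: positions in `+s`
start with `0`, those in `-t` with `1`. -/
def node (s t : Trm S ℕ) : List ℕ → Option (Bool × Trm S ℕ)
  | 0 :: p => s.nodeAt true p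
  | 1 :: p => t.nodeAt false p
  | _ => none

/-- The node at position `p` is a leaf with sign `σ`, labelled by the variable `x`. -/
def IsLeaf (s t : Trm S ℕ) (p : List ℕ) (σ : Bool) (x : ℕ) : Prop :=
  node s t p = some (σ, .var x)

/-- `+f` and `-g` nodes. -/
def DefSkelNode : Bool × Trm S ℕ → Prop
  | (σ, .op h _) => S.isF h = σ
  | _ => False

/-- `+g` and `-f` nodes. -/
def DefPIANode : Bool × Trm S ℕ → Prop
  | (σ, .op h _) => S.isF h = !σ
  | _ => False

/-- `+∧` and `-∨` nodes. -/
def MeetNode : Bool × Trm S ℕ → Prop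
  | (σ, .inf _ _) => σ = true
  | (σ, .sup _ _) => σ = false
  | _ => False

/-- Non-unary `+g` and `-f` nodes. -/
def SRRNode : Bool × Trm S ℕ → Prop
  | (σ, .op h _) => S.isF h = (!σ) ∧ S.arity h ≠ 1
  | _ => False

/-- The branch ending in position `l` consists, from the root, of definite skeleton nodes (those
at depth below `a`), then of `+∧`, `-∨` nodes (depth below `b`), then of definite PIA nodes. -/
def BranchShape (s t : Trm S ℕ) (l : List ℕ) (a b : ℕ) : Prop :=
  a ≤ b ∧ ∀ q nd, q <+: l → q ≠ l → node s t q = some nd →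
    (q.length < a ∧ DefSkelNode nd) ∨
    (a ≤ q.length ∧ q.length < b ∧ MeetNode nd) ∨
    (b ≤ q.length ∧ DefPIANode nd)

/-- `s ≤ t` is refined `(Ω, ε)`-inductive. -/
def IsInductiveFor (ε : ℕ → Bool) (Ω : ℕ → ℕ → Prop) (s t : Trm S ℕ) : Prop :=
  (∀ l x, IsLeaf s t l (ε x) x → ∃ a b, BranchShape s t l a b) ∧
  (∀ l x, IsLeaf s t l (ε x) x → ∀ q nd, q <+: l → q ≠ l → node s t q = some nd → SRRNode nd →
    (∀ l' x', q <+: l' → IsLeaf s t l' (ε x') x' → l' = l) ∧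
    (∀ l' σ y, q <+: l' → IsLeaf s t l' σ y → y ≠ x → Ω y x))

/-- Every variable that occurs in the inequality occurs in it with both signs. -/
def NoUniform (s t : Trm S ℕ) : Prop :=
  ∀ l σ x, IsLeaf s t l σ x → ∃ l', IsLeaf s t l' (!σ) x

/-- Strict partial orders. -/
def IsStrict (Ω : ℕ → ℕ → Prop) : Prop :=
  (∀ x, ¬ Ω x x) ∧ ∀ x y z, Ω x y → Ω y z → Ω x z

/-- `s ≤ t` is a refined inductive inequality. -/
def IsInductive (s t : Trm S ℕ) : Prop :=
  (∃ ε Ω, IsStrict Ω ∧ IsInductiveFor ε Ω s t) ∧ NoUniform s t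

/-- Very simple `ε`-Sahlqvist shape: above an `ε`-critical leaf there are only definite skeleton
nodes. In the version `meets = true`, the critical variable may also be a member of a finite
meet (at a positive position) or join (at a negative position) below the definite skeleton. -/
def IsVerySimple (meets : Bool) (ε : ℕ → Bool) (s t : Trm S ℕ) : Prop :=
  ∀ l x, IsLeaf s t l (ε x) x →
    ∃ a, BranchShape s t l a l.length ∧ (meets = false → a = l.length)

end Trees

/-! ### Crypto-inductive inequalities -/

section Crypto

variable {S : LESig.{v}}

/-- Leaves that are labelled by a variable and are not `ε`-critical. -/
def IsNonCritical (ε : ℕ → Bool) (s t : Trm S.star ℕ) (l : List ℕ) : Prop :=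
  ∃ x, IsLeaf s t l (!(ε x)) x

/-- The conditions on the subtree rooted at `r`, as a candidate for the tree `MVTree(l)` of a
leaf `l`, that do not refer to the trees of other leaves. -/
structure MVCandidate (ε : ℕ → Bool) (Ω : ℕ → ℕ → Prop) (s t : Trm S.star ℕ)
    (l r : List ℕ) : Prop where
  mem : r <+: l ∧ r ≠ []
  /-- the path to `l` consists of negative `F*`-nodes and positive `G*`-nodes that are
  residuation-conservative in the coordinate containing `l` -/
  path : ∀ q k, r <+: q → q ++ [k] <+: l →
    ∃ σ h args, node s t q = some (σ, Trm.op h args) ∧ StarOp.isF h = (!σ) ∧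
      StarOp.Conservative h k
  /-- no `Ω`-larger variable occurs in the subtree -/
  vars : ∀ σ x, IsLeaf s t l σ x → ∀ l' τ y, r <+: l' → IsLeaf s t l' τ y → ¬ Ω x y
  /-- no critical leaf occurs in the subtree -/
  noncrit : ∀ l' y, r <+: l' → ¬ IsLeaf s t l' (ε y) y
  /-- if the topmost node carries a connective, it is a new one -/
  topmost : ∀ σ h args, node s t r = some (σ, Trm.op h args) → ¬ StarOp.IsBase h

/-- Candidates whose topmost node does not lie in the path to `l'` in `MVTree(l')`, for any leaf
`l'` occurring to the left of `l`; here `M l'` is the root of `MVTree(l')`. -/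
def MVAdmissible (ε : ℕ → Bool) (Ω : ℕ → ℕ → Prop) (s t : Trm S.star ℕ)
    (M : List ℕ → List ℕ) (l r : List ℕ) : Prop :=
  MVCandidate ε Ω s t l r ∧
  ∀ l', IsNonCritical ε s t l' → List.Lex (· < ·) l' l → ¬ (M l' <+: r ∧ r <+: l')

/-- `M` assigns to every non-critical leaf `l` the root of `MVTree(l)`, i.e. of the largest
admissible subtree. (This determines `M` on the non-critical leaves, from left to right.) -/
def IsMVTree (ε : ℕ → Bool) (Ω : ℕ → ℕ → Prop) (s t : Trm S.star ℕ)
    (M : List ℕ → List ℕ) : Prop :=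
  ∀ l, IsNonCritical ε s t l →
    MVAdmissible ε Ω s t M l (M l) ∧ ∀ r, MVAdmissible ε Ω s t M l r → M l <+: r

/-- The conditions of crypto-inductivity with respect to given `ε` and `Ω`. -/
structure IsCryptoFor (meets : Bool) (ε : ℕ → Bool) (Ω : ℕ → ℕ → Prop)
    (s t : Trm S.star ℕ) : Prop where
  verySimple : IsVerySimple meets ε s t
  /-- critical branches contain only connectives of the original language -/
  critical : ∀ l x, IsLeaf s t l (ε x) x → ∀ q σ h args, q <+: l →
    node s t q = some (σ, Trm.op h args) → StarOp.IsBase h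
  strict : IsStrict Ω
  /-- every occurrence of a new connective lies in the path to a non-critical leaf `l` from the
  root of `MVTree(l)` -/
  covered : ∃ M, IsMVTree ε Ω s t M ∧
    ∀ q σ h args, node s t q = some (σ, Trm.op h args) → ¬ StarOp.IsBase h →
      ∃ l, IsNonCritical ε s t l ∧ M l <+: q ∧ q <+: l
  /-- every occurrence of a new connective has an `Ω`-largest variable in its scope -/
  largest : ∀ q σ h args, node s t q = some (σ, Trm.op h args) → ¬ StarOp.IsBase h →
    ∃ l τ x, q <+: l ∧ IsLeaf s t l τ x ∧
      ∀ l' τ' y, q <+: l' → IsLeaf s t l' τ' y → y ≠ x → Ω y x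

/-- Crypto-inductive inequalities of the fully residuated language of `S`. -/
def IsCryptoInductive (meets : Bool) (s t : Trm S.star ℕ) : Prop :=
  (∃ ε Ω, IsCryptoFor meets ε Ω s t) ∧ NoUniform s t

end Crypto

/-! ### The first-order language for inverse correspondence -/

/-- Pure variables: nominals and conominals. -/
inductive PureVar : Type
  | nom (n : ℕ) : PureVar
  | cnom (n : ℕ) : PureVar
  deriving DecidableEq

namespace PureVar

def isNom : PureVar → Bool
  | nom _ => true
  | cnom _ => false

/-- The propositional variable introduced for a pure variable. -/
def toProp : PureVar → ℕ
  | nom n => 2 * n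
  | cnom n => 2 * n + 1

end PureVar

/-- First-order formulas whose atoms are pure inequalities of the fully residuated language. -/
inductive FO (S : LESig.{v}) : Type v
  | le (s t : Trm S.star PureVar) : FO S
  | neg (a : FO S) : FO S
  | and (a b : FO S) : FO S
  | or (a b : FO S) : FO S
  | imp (a b : FO S) : FO S
  | all (x : PureVar) (a : FO S) : FO S
  | ex (x : PureVar) (a : FO S) : FO S

namespace FO

variable {S : LESig.{v}}

def allL (xs : List PureVar) (a : FO S) : FO S := xs.foldr FO.all a

def exL (xs : List PureVar) (a : FO S) : FO S := xs.foldr FO.ex a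

/-- `a₁ ∧ (a₂ ∧ ⋯ ∧ c)` -/
def andThen (as : List (FO S)) (c : FO S) : FO S := as.foldr FO.and c

/-- `a₁ ∨ (a₂ ∨ ⋯ ∨ c)` -/
def orThen (as : List (FO S)) (c : FO S) : FO S := as.foldr FO.or c

/-- `a₁ ∧ ⋯ ∧ aₙ → c`, which is just `c` if `n = 0` -/
def impThen : List (FO S) → FO S → FO S
  | [], c => c
  | a :: as, c => imp (andThen (a :: as).dropLast ((a :: as).getLast (List.cons_ne_nil a as))) c

/-- `x` occurs in some atom of the formula. -/
def Occurs (x : PureVar) : FO S → Prop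
  | le s t => 0 < s.count x + t.count x
  | neg a => a.Occurs x
  | and a b => a.Occurs x ∨ b.Occurs x
  | or a b => a.Occurs x ∨ b.Occurs x
  | imp a b => a.Occurs x ∨ b.Occurs x
  | all _ a => a.Occurs x
  | ex _ a => a.Occurs x

/-- For a nominal `v = j` the inequality `j ≤ ξ`, for a conominal `v = m` the inequality
`ξ ≤ m`. -/
def bound (v : PureVar) (ξ : Trm S.star PureVar) : FO S :=
  if v.isNom = true then le (.var v) ξ else le ξ (.var v)

end FO

namespace PerfectLE

variable {S : LESig.{v}}

/-- Nominals range over the completely join-irreducible elements, conominals over the completely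
meet-irreducible ones. -/
def InRange (A : PerfectLE.{u} S) : PureVar → A.carrier → Prop
  | .nom _, a => CJI a
  | .cnom _, a => CMI a

def Sat (A : PerfectLE.{u} S) : (PureVar → A.carrier) → FO S → Prop
  | x, .le s t => s.eval A.opStar x ≤ t.eval A.opStar x
  | x, .neg a => ¬ A.Sat x a
  | x, .and a b => A.Sat x a ∧ A.Sat x b
  | x, .or a b => A.Sat x a ∨ A.Sat x b
  | x, .imp a b => A.Sat x a → A.Sat x b
  | x, .all y a => ∀ c, A.InRange y c → A.Sat (Function.update x y c) a
  | x, .ex y a => ∃ c, A.InRange y c ∧ A.Sat (Function.update x y c) a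

/-- Truth of a closed formula (its value does not depend on the assignment). -/
def Models (A : PerfectLE.{u} S) (χ : FO S) : Prop := ∀ x : PureVar → A.carrier, A.Sat x χ

end PerfectLE

/-! ### Inverse correspondents -/

/-- `ξ ∧ ζ` if `v` is a nominal, `ξ ∨ ζ` if `v` is a conominal. -/
def meetFor {S : LESig.{v}} (v : PureVar) (ξ ζ : Trm S.star PureVar) : Trm S.star PureVar :=
  if v.isNom = true then .inf ξ ζ else .sup ξ ζ

/-- `InvDisj E true v θ ξ` (resp. `InvDisj E false v θ ξ`): `θ` is a positive (resp. negative)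
inverse disjunct with pure variable `v`, and compaction turns it into the inequality
`bound v ξ` (resp. its negation). `E` is the set of outer variables that may occur in the
inequalities of the base case: there, nominals have to be negative and conominals positive, where
the sign is computed in `+α`, `-β` for `α ≤ β` and in `-α`, `+β` for `α ≰ β`. The term next to
`v = j` in `j ≤ ψ` is a negative skeleton, the term next to `v = m` in `φ ≤ m` is a positive one.
In the quantifier case the skeleton is definite, it contains each quantified variable exactly
once (`ψ` is a term over `Fin (n + 1)`, whose `i`-th variable stands for `us i`), and in the
signed tree `-ψ`, resp. `+φ`, positive leaves are nominals and negative leaves are conominals. -/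
inductive InvDisj {S : LESig.{v}} (E : PureVar → Prop) :
    Bool → PureVar → FO S → Trm S.star PureVar → Prop
  | basePos (v : PureVar) (ψ : Trm S.star PureVar) :
      ψ.Skel false (!v.isNom) → ψ.VarsIn E → ψ.LeafSign (fun x => !x.isNom) (!v.isNom) →
      InvDisj E true v (FO.bound v ψ) ψ
  | baseNeg (v : PureVar) (ψ : Trm S.star PureVar) :
      ψ.Skel false (!v.isNom) → ψ.VarsIn E → ψ.LeafSign (fun x => x.isNom) (!v.isNom) →
      InvDisj E false v (FO.neg (FO.bound v ψ)) ψ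
  | conj (v : PureVar) (θ₁ θ₂ : FO S) (ξ₁ ξ₂ : Trm S.star PureVar) :
      InvDisj E true v θ₁ ξ₁ → InvDisj E true v θ₂ ξ₂ →
      InvDisj E true v (FO.and θ₁ θ₂) (meetFor v ξ₁ ξ₂)
  | disj (v : PureVar) (θ₁ θ₂ : FO S) (ξ₁ ξ₂ : Trm S.star PureVar) :
      InvDisj E false v θ₁ ξ₁ → InvDisj E false v θ₂ ξ₂ →
      InvDisj E false v (FO.or θ₁ θ₂) (meetFor v ξ₁ ξ₂)
  | quantPos (v : PureVar) (n : ℕ) (us : Fin (n + 1) → PureVar) (θ : Fin (n + 1) → FO S)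
      (ξ : Fin (n + 1) → Trm S.star PureVar) (ψ : Trm S.star (Fin (n + 1))) :
      Function.Injective us → (∀ i, us i ≠ v ∧ ¬ E (us i)) →
      ψ.Skel true (!v.isNom) → (∀ i, ψ.count i = 1) →
      ψ.LeafSign (fun i => (us i).isNom) (!v.isNom) →
      (∀ i, InvDisj E false (us i) (θ i) (ξ i)) → (∀ i, ¬ (θ i).Occurs v) →
      InvDisj E true v
        (FO.allL (List.ofFn us) (FO.imp (FO.neg (FO.bound v (ψ.rename us)))
          (FO.orThen (List.ofFn fun i : Fin n => θ i.castSucc) (θ (Fin.last n)))))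
        (ψ.bind ξ)
  | quantNeg (v : PureVar) (n : ℕ) (us : Fin (n + 1) → PureVar) (θ : Fin (n + 1) → FO S)
      (ξ : Fin (n + 1) → Trm S.star PureVar) (ψ : Trm S.star (Fin (n + 1))) :
      Function.Injective us → (∀ i, us i ≠ v ∧ ¬ E (us i)) →
      ψ.Skel true (!v.isNom) → (∀ i, ψ.count i = 1) →
      ψ.LeafSign (fun i => (us i).isNom) (!v.isNom) →
      (∀ i, InvDisj E true (us i) (θ i) (ξ i)) → (∀ i, ¬ (θ i).Occurs v) →
      InvDisj E false v
        (FO.exL (List.ofFn us)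
          (FO.andThen (List.ofFn θ) (FO.neg (FO.bound v (ψ.rename us)))))
        (ψ.bind ξ)

/-- The data of a pre-inverse correspondent: its universally quantified variables `us`, those of
them that carry a negative inverse disjunct `θ` (`con`, the variables in `j̄`, `m̄`), those that
may occur in the inequalities of the disjuncts (`free`, the variables in `ī`, `n̄`; the two groups
may overlap), and the inequality `φ ≤ ψ` between definite skeletons, given as terms over `Fin n`,
in which each variable occurs exactly once, nominals positively and conominals negatively. -/
structure PreInverse (S : LESig.{v}) where
  n : ℕ
  us : Fin n → PureVar
  us_inj : Function.Injective us
  con : Fin n → Bool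
  free : Fin n → Bool
  cover : ∀ k, con k = true ∨ free k = true
  θ : Fin n → FO S
  ξ : Fin n → Trm S.star PureVar
  θ_inv : ∀ k, con k = true →
    InvDisj (fun x => ∃ i, free i = true ∧ us i = x) false (us k) (θ k) (ξ k)
  φ : Trm S.star (Fin n)
  ψ : Trm S.star (Fin n)
  φ_skel : φ.Skel true true
  ψ_skel : ψ.Skel true false
  once : ∀ k, φ.count k + ψ.count k = 1
  φ_sign : φ.LeafSign (fun k => (us k).isNom) true
  ψ_sign : ψ.LeafSign (fun k => (us k).isNom) false

namespace PreInverse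

variable {S : LESig.{v}} (D : PreInverse S)

/-- The indices of the variables that carry an inverse disjunct. -/
def conList : List (Fin D.n) := (List.finRange D.n).filter fun k => D.con k

/-- The formula `∀ us (θ₁ ∨ ⋯ ∨ θᵣ ∨ φ ≤ ψ)`. -/
def formula : FO S :=
  FO.allL (List.ofFn D.us)
    (FO.orThen (D.conList.map D.θ) (FO.le (D.φ.rename D.us) (D.ψ.rename D.us)))

/-- The formula `∀ us (¬θ₁ ∧ ⋯ ∧ ¬θᵣ → φ ≤ ψ)`. -/
def formulaImp : FO S :=
  FO.allL (List.ofFn D.us)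
    (FO.impThen (D.conList.map fun k => FO.neg (D.θ k))
      (FO.le (D.φ.rename D.us) (D.ψ.rename D.us)))

/-- The term that replaces a variable of `φ ≤ ψ`. -/
def repl (k : Fin D.n) : Trm S.star PureVar :=
  if D.con k = true then
    if D.free k = true then meetFor (D.us k) (D.ξ k) (.var (D.us k)) else D.ξ k
  else .var (D.us k)

/-- Left-hand side of the associated inequality. -/
def lhs : Trm S.star ℕ := (D.φ.bind D.repl).rename PureVar.toProp

/-- Right-hand side of the associated inequality. -/
def rhs : Trm S.star ℕ := (D.ψ.bind D.repl).rename PureVar.toProp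

end PreInverse

/-- Inverse correspondents: pre-inverse correspondents (in either of the two shapes) whose
associated inequality satisfies the conditions of crypto-inductivity. That no variable occurs
uniformly in the associated inequality is not required here. -/
def IsInverseCorrespondent {S : LESig.{v}} (meets : Bool) (χ : FO S) : Prop :=
  ∃ D : PreInverse S, (χ = D.formula ∨ χ = D.formulaImp) ∧
    ∃ ε Ω, IsCryptoFor meets ε Ω D.lhs D.rhs

end InvCorr

/-!
An inverse correspondent is first turned into its associated inequality, and the latter into an
inequality of the original language by naming the subterms that are headed by residuals.

*Correspondence.* In a perfect LE every connective of the fully residuated language is residuated in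
every coordinate (`PerfectLE.residuated_opStar`), hence so is a definite skeleton in every variable
that occurs in it once (`Trm.Skel.residuated`). As the completely join-irreducible elements are
join-generating and dually, the inequalities with such skeletons may be tested on generators
(`PerfectLE.iff_forall_gen`). By induction, an inverse disjunct is thus equivalent to the inequality
between its main variable and its compaction, or to its negation (`InvDisj.sat_iff`). A pre-inverse
correspondent then is equivalent to its associated inequality, by Ackermann's argument
(`PreInverse.truth_iff_validStar`). Crypto-inductivity plays no role in this.

*Uniform variables* are eliminated by substituting `⊤` or `⊥` (`valid_elimUniform_iff`). For
inductive inequalities this is harmless. For crypto-inductive ones it might destroy the leaves that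
justify a new connective; but in an associated inequality, a variable with an occurrence below a
definite PIA node also has an occurrence of the opposite sign in the skeleton, so that no such leaf
is uniform (`PreInverse.not_defPIANode_above_uniform`).

*Elimination of the new connectives.* A new connective is residuation-conservative in exactly one
coordinate, so each subterm `T` with a new connective at its root determines a single path of new
connectives, which ends in a non-critical leaf, labelled `x` say (`MVCandidate.chain`). Along this
path, `T ≤ p` can be solved by adjunction as `x ≤ solve T p`, up to the signs, where the solution is
a PIA term over the original connectives with `p` on its main branch. So `T` is replaced by a fresh
variable `p`, and the critical occurrences of `x` by the meets of `x` and of all such solutions. This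
yields an equivalent inequality (`validStar_iff_valid_translate`): from left to right `x` is
instantiated by this meet, from right to left `p` by `T`. In the new inequality the fresh variables
have their critical occurrences in the solutions only, below skeleton nodes and then meets. The
other variables in the solution for `p` are old ones, or stand for proper subterms of `T`; so it is
inductive for the order in which the old variables are the smallest and the fresh ones are compared
by the sizes of the chains (`exists_goodLeaf_translate`).
-/

namespace InvCorr

/-! ### Signed order and residuated interpretations -/

/-- The order of a lattice (`σ = true`) or of its dual (`σ = false`). -/
def SgLE {A : Type u} [CompleteLattice A] : Bool → A → A → Prop
  | true, a, b => a ≤ b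
  | false, a, b => b ≤ a

section SgLE

variable {A : Type u} [CompleteLattice A]

@[simp] theorem sgLE_true (a b : A) : SgLE true a b ↔ a ≤ b := Iff.rfl

@[simp] theorem sgLE_false (a b : A) : SgLE false a b ↔ b ≤ a := Iff.rfl

theorem sgLE_not (σ : Bool) (a b : A) : SgLE (!σ) a b ↔ SgLE σ b a := by
  cases σ <;> rfl

theorem SgLE.refl (σ : Bool) (a : A) : SgLE σ a a := by
  cases σ <;> exact le_refl a

theorem SgLE.trans {σ : Bool} {a b c : A} (h : SgLE σ a b) (h' : SgLE σ b c) : SgLE σ a c := by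
  cases σ
  · exact le_trans h' h
  · exact le_trans h h'

theorem sgSup_sgLE_iff (σ : Bool) (X : Set A) (b : A) :
    SgLE σ (sgSup σ X) b ↔ ∀ a ∈ X, SgLE σ a b := by
  cases σ
  · simp [sgSup, SgLE]
  · simp [sgSup, SgLE]

theorem sgLE_sgSup (σ : Bool) {X : Set A} {a : A} (h : a ∈ X) : SgLE σ a (sgSup σ X) :=
  (sgSup_sgLE_iff σ X _).1 (SgLE.refl σ _) a h

end SgLE

/-- Every connective has a residual in every coordinate, in the order-theoretic sense: with the
other arguments fixed, it is a left adjoint between the lattices or their duals prescribed by the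
order type. -/
def Residuated {S : LESig.{v}} {A : Type u} [CompleteLattice A]
    (I : (h : S.Op) → (Fin (S.arity h) → A) → A) : Prop :=
  ∀ (h : S.Op) (k : Fin (S.arity h)) (x : Fin (S.arity h) → A) (b : A),
    ∃ r, ∀ a, SgLE (S.isF h) (I h (Function.update x k a)) b ↔ SgLE (S.isF h == S.tp h k) a r

section Residuated

variable {S : LESig.{v}} {A : Type u} [CompleteLattice A]
  {I : (h : S.Op) → (Fin (S.arity h) → A) → A}

theorem Residuated.mono_update (hI : Residuated I) (h : S.Op) (k : Fin (S.arity h))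
    (x : Fin (S.arity h) → A) {a b : A} (hab : SgLE (S.tp h k) a b) :
    I h (Function.update x k a) ≤ I h (Function.update x k b) := by
  cases hF : S.isF h
  · obtain ⟨r, hr⟩ := hI h k x (I h (Function.update x k a))
    rw [hF] at hr
    have h1 := (hr a).1 (SgLE.refl _ _)
    refine (hr b).2 (SgLE.trans ?_ h1)
    simpa [sgLE_not] using hab
  · obtain ⟨r, hr⟩ := hI h k x (I h (Function.update x k b))
    rw [hF] at hr
    have h1 := (hr b).1 (SgLE.refl _ _)
    refine (hr a).2 (SgLE.trans ?_ h1)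
    simpa using hab

theorem Residuated.mono (hI : Residuated I) (h : S.Op) {x y : Fin (S.arity h) → A}
    (hxy : ∀ k, SgLE (S.tp h k) (x k) (y k)) : I h x ≤ I h y := by
  classical
  have key : ∀ s : Finset (Fin (S.arity h)), I h x ≤ I h (s.piecewise y x) := by
    intro s
    induction s using Finset.induction_on with
    | empty => simp
    | insert i s hi ih =>
      refine ih.trans ?_
      rw [Finset.piecewise_insert]
      have : s.piecewise y x = Function.update (s.piecewise y x) i (x i) := by
        rw [eq_comm, Function.update_eq_self_iff]; simp [hi]
      conv_lhs => rw [this]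
      exact hI.mono_update h i _ (hxy i)
  simpa using key Finset.univ

theorem Residuated.sgMono (hI : Residuated I) (h : S.Op) (σ : Bool) {x y : Fin (S.arity h) → A}
    (hxy : ∀ k, SgLE (σ == S.tp h k) (x k) (y k)) : SgLE σ (I h x) (I h y) := by
  cases σ
  · exact hI.mono h fun k => by simpa [sgLE_not] using hxy k
  · exact hI.mono h fun k => by simpa using hxy k

end Residuated

namespace PerfectLE

variable {S : LESig.{v}} (A : PerfectLE.{u} S)

theorem op_update_sgSup (h : S.Op) (i : Fin (S.arity h)) (x : Fin (S.arity h) → A.carrier)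
    (X : Set A.carrier) :
    A.op h (Function.update x i (sgSup (S.isF h == S.tp h i) X)) =
      sgSup (S.isF h) ((fun a => A.op h (Function.update x i a)) '' X) := by
  cases hF : S.isF h
  · have := A.map_G h i x X hF
    simpa [sgSup] using this
  · have := A.map_F h i x X hF
    simpa [sgSup] using this

theorem sgLE_op_mono_update (h : S.Op) (i : Fin (S.arity h)) (x : Fin (S.arity h) → A.carrier)
    {a b : A.carrier} (hab : SgLE (S.isF h == S.tp h i) a b) :
    SgLE (S.isF h) (A.op h (Function.update x i a)) (A.op h (Function.update x i b)) := by
  have hb : b = sgSup (S.isF h == S.tp h i) {a, b} := by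
    revert hab
    cases (S.isF h == S.tp h i) <;> intro hab
    · simpa [sgSup] using hab
    · simpa [sgSup] using hab
  rw [hb, op_update_sgSup]
  exact sgLE_sgSup _ ⟨a, by simp, rfl⟩

/-- The defining adjunction of the residuals. -/
theorem adjunction (h : S.Op) (i : Fin (S.arity h)) (x : Fin (S.arity h) → A.carrier)
    (a : A.carrier) :
    SgLE (S.isF h) (A.op h (Function.update x i a)) (x i) ↔
      SgLE (S.isF h == S.tp h i) a (A.opStar (.res h i) x) := by
  have hdef : A.opStar (.res h i) x = sgSup (S.isF h == S.tp h i)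
      {a | SgLE (S.isF h) (A.op h (Function.update x i a)) (x i)} := by
    cases hF : S.isF h <;> simp [opStar, hF, SgLE]
  rw [hdef]
  constructor
  · intro ha
    exact sgLE_sgSup _ ha
  · intro ha
    refine (A.sgLE_op_mono_update h i x ha).trans ?_
    rw [op_update_sgSup, sgSup_sgLE_iff]
    rintro _ ⟨c, hc, rfl⟩
    exact hc

theorem residuated_op : Residuated A.op := by
  intro h k x b
  refine ⟨A.opStar (.res h k) (Function.update x k b), fun a => ?_⟩
  have := A.adjunction h k (Function.update x k b) a
  simpa using this

theorem residuated_opStar : Residuated (S := S.star) A.opStar := by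
  rintro (h | ⟨h, i⟩) k x b
  · exact A.residuated_op h k x b
  · change Fin (S.arity h) at k
    change Fin (S.arity h) → A.carrier at x
    have hb : ∀ y : Fin (S.arity h) → A.carrier,
        SgLE (StarOp.isF (.res h i)) (A.opStar (.res h i) y) b ↔
          SgLE (S.isF h) (A.op h (Function.update y i b)) (y i) := by
      intro y
      rw [A.adjunction, ← sgLE_not]
      simp only [StarOp.isF]
      cases S.isF h <;> cases S.tp h i <;> rfl
    change ∃ r, ∀ a, SgLE (StarOp.isF (.res h i))
      (A.opStar (.res h i) (Function.update x k a)) b ↔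
        SgLE (StarOp.isF (.res h i) == StarOp.tp (.res h i) k) a r
    by_cases hk : k = i
    · subst hk
      refine ⟨A.op h (Function.update x k b), fun a => ?_⟩
      rw [hb, ← sgLE_not]
      simp only [StarOp.isF, StarOp.tp, Function.update_idem, Function.update_self, if_true]
      cases S.isF h <;> cases S.tp h k <;> rfl
    · obtain ⟨r, hr⟩ := A.residuated_op h k (Function.update x i b) (x i)
      refine ⟨r, fun a => ?_⟩
      rw [hb, Function.update_comm hk, Function.update_of_ne (Ne.symm hk), hr]
      simp only [StarOp.isF, StarOp.tp, if_neg hk]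
      cases S.isF h <;> cases S.tp h i <;> cases S.tp h k <;> rfl

/-- The elements over which nominals (`σ = true`) and conominals (`σ = false`) range. -/
def Gen (σ : Bool) (a : A.carrier) : Prop := if σ = true then CJI a else CMI a

theorem inRange_iff (v : PureVar) (a : A.carrier) : A.InRange v a ↔ A.Gen v.isNom a := by
  cases v <;> simp [InRange, Gen, PureVar.isNom]

theorem sgLE_iff_gen (σ : Bool) (a b : A.carrier) :
    SgLE σ a b ↔ ∀ c, A.Gen σ c → SgLE σ c a → SgLE σ c b := by
  refine ⟨fun h c _ hc => hc.trans h, fun h => ?_⟩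
  cases σ
  · change b ≤ a
    rw [A.meet_gen a]
    exact le_sInf fun c hc => h c (by simpa [Gen] using hc.1) hc.2
  · change a ≤ b
    rw [A.join_gen a]
    exact sSup_le fun c hc => h c (by simpa [Gen] using hc.1) hc.2

/-- A condition on tuples that is residuated in every coordinate may be tested on tuples of
generators. -/
theorem iff_forall_gen {n : ℕ} (f : Fin n → Bool) (Q : (Fin n → A.carrier) → Prop)
    (hQ : ∀ z i, ∃ r, ∀ a, Q (Function.update z i a) ↔ SgLE (f i) a r) (z : Fin n → A.carrier) :
    Q z ↔ ∀ c, (∀ i, A.Gen (f i) (c i) ∧ SgLE (f i) (c i) (z i)) → Q c := by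
  classical
  -- the coordinates are replaced by generators one after the other
  have key : ∀ s : Finset (Fin n), Q z ↔ ∀ c : Fin n → A.carrier,
      (∀ i ∈ s, A.Gen (f i) (c i) ∧ SgLE (f i) (c i) (z i)) → (∀ i ∉ s, c i = z i) → Q c := by
    intro s
    induction s using Finset.induction_on with
    | empty =>
      constructor
      · intro h c _ hc
        rwa [show c = z from funext fun i => hc i (by simp)]
      · intro h
        exact h z (by simp) (by simp)
    | insert i s hi ih =>
      rw [ih]
      constructor
      · intro h c hc hc'
        obtain ⟨r, hr⟩ := hQ c i
        have h1 : Q (Function.update c i (z i)) := by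
          refine h _ (fun k hk => ?_) (fun k hk => ?_)
          · have : k ≠ i := fun e => hi (e ▸ hk)
            simpa [this] using hc k (Finset.mem_insert_of_mem hk)
          · by_cases e : k = i
            · subst e; simp
            · simpa [e] using hc' k (by simp [e, hk])
        have h2 := (hr (c i)).2 ((hc i (by simp)).2.trans ((hr _).1 h1))
        simpa using h2
      · intro h c hc hc'
        obtain ⟨r, hr⟩ := hQ c i
        have h1 : Q (Function.update c i (z i)) := by
          rw [hr, sgLE_iff_gen A]
          intro d hd hdz
          rw [← hr]
          refine h _ (fun k hk => ?_) (fun k hk => ?_)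
          · by_cases e : k = i
            · subst e; simpa using ⟨hd, hdz⟩
            · simpa [e] using hc k ((Finset.mem_insert.1 hk).resolve_left e)
          · simp only [Finset.mem_insert, not_or] at hk
            simpa [hk.1] using hc' k hk.2
        rwa [← hc' i hi, Function.update_eq_self] at h1
  simpa using key Finset.univ

end PerfectLE

/-! ### Terms: evaluation, leaves and substitution -/

namespace Trm

section General

variable {S : LESig.{v}} {V W X : Type}

theorem eval_bind {A : Type u} [CompleteLattice A] (I : (h : S.Op) → (Fin (S.arity h) → A) → A)
    (x : W → A) (f : V → Trm S W) (t : Trm S V) :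
    (t.bind f).eval I x = t.eval I fun y => (f y).eval I x := by
  induction t with
  | var y => rfl
  | top => rfl
  | bot => rfl
  | inf a b iha ihb => simp [bind, eval, iha, ihb]
  | sup a b iha ihb => simp [bind, eval, iha, ihb]
  | op h args ih => simp [bind, eval, ih]

theorem eval_rename {A : Type u} [CompleteLattice A]
    (I : (h : S.Op) → (Fin (S.arity h) → A) → A) (x : W → A) (f : V → W) (t : Trm S V) :
    (t.rename f).eval I x = t.eval I fun y => x (f y) := eval_bind _ _ _ _

@[simp] theorem nodeAt_nil (σ : Bool) (t : Trm S V) : t.nodeAt σ [] = some (σ, t) := rfl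

@[simp] theorem nodeAt_op_cons (σ : Bool) (h : S.Op) (args : Fin (S.arity h) → Trm S V) (k : ℕ)
    (p : List ℕ) : (op h args).nodeAt σ (k :: p) =
      if hk : k < S.arity h then (args ⟨k, hk⟩).nodeAt (σ == S.tp h ⟨k, hk⟩) p else none := by
  by_cases hk : k < S.arity h <;> simp [nodeAt, child, hk]

@[simp] theorem nodeAt_inf_cons (σ : Bool) (a b : Trm S V) (k : ℕ) (p : List ℕ) :
    (inf a b).nodeAt σ (k :: p) =
      if k = 0 then a.nodeAt σ p else if k = 1 then b.nodeAt σ p else none := by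
  by_cases h0 : k = 0
  · simp [nodeAt, child, h0]
  · by_cases h1 : k = 1 <;> simp [nodeAt, child, h0, h1]

@[simp] theorem nodeAt_sup_cons (σ : Bool) (a b : Trm S V) (k : ℕ) (p : List ℕ) :
    (sup a b).nodeAt σ (k :: p) =
      if k = 0 then a.nodeAt σ p else if k = 1 then b.nodeAt σ p else none := by
  by_cases h0 : k = 0
  · simp [nodeAt, child, h0]
  · by_cases h1 : k = 1 <;> simp [nodeAt, child, h0, h1]

@[simp] theorem nodeAt_var_cons (σ : Bool) (x : V) (k : ℕ) (p : List ℕ) :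
    (var x : Trm S V).nodeAt σ (k :: p) = none := by simp [nodeAt, child]

@[simp] theorem nodeAt_top_cons (σ : Bool) (k : ℕ) (p : List ℕ) :
    (top : Trm S V).nodeAt σ (k :: p) = none := by simp [nodeAt, child]

@[simp] theorem nodeAt_bot_cons (σ : Bool) (k : ℕ) (p : List ℕ) :
    (bot : Trm S V).nodeAt σ (k :: p) = none := by simp [nodeAt, child]

theorem nodeAt_op_fin (σ : Bool) (h : S.Op) (args : Fin (S.arity h) → Trm S V)
    (k : Fin (S.arity h)) (p : List ℕ) :
    (op h args).nodeAt σ (k.val :: p) = (args k).nodeAt (σ == S.tp h k) p := by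
  simp

theorem nodeAt_append (σ : Bool) (t : Trm S V) (p q : List ℕ) :
    t.nodeAt σ (p ++ q) = (t.nodeAt σ p).bind fun nd => nd.2.nodeAt nd.1 q := by
  induction p generalizing σ t with
  | nil => rfl
  | cons k p ih =>
    simp only [List.cons_append, nodeAt]
    cases t.child k with
    | none => rfl
    | some c => exact ih _ _

/-- The value of a term is monotone in the positive and antitone in the negative leaves. -/
theorem sgLE_eval {A : Type u} [CompleteLattice A] {I : (h : S.Op) → (Fin (S.arity h) → A) → A}
    (hI : Residuated I) {x y : V → A} (t : Trm S V) (σ : Bool)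
    (hxy : ∀ l τ z, t.nodeAt σ l = some (τ, var z) → SgLE τ (x z) (y z)) :
    SgLE σ (t.eval I x) (t.eval I y) := by
  induction t generalizing σ with
  | var z => exact hxy [] σ z rfl
  | top => exact SgLE.refl _ _
  | bot => exact SgLE.refl _ _
  | inf a b iha ihb =>
    have ha := iha σ fun l τ z h => hxy (0 :: l) τ z (by simpa using h)
    have hb := ihb σ fun l τ z h => hxy (1 :: l) τ z (by simpa using h)
    cases σ <;> exact inf_le_inf ha hb
  | sup a b iha ihb =>
    have ha := iha σ fun l τ z h => hxy (0 :: l) τ z (by simpa using h)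
    have hb := ihb σ fun l τ z h => hxy (1 :: l) τ z (by simpa using h)
    cases σ <;> exact sup_le_sup ha hb
  | op h args ih =>
    exact hI.sgMono h σ fun k => ih k _ fun l τ z hl =>
      hxy (k.val :: l) τ z (by rw [nodeAt_op_fin]; exact hl)

theorem LeafSign.sign_eq {f : V → Bool} {t : Trm S V} {σ : Bool} (ht : t.LeafSign f σ)
    {l : List ℕ} {τ : Bool} {z : V} (hl : t.nodeAt σ l = some (τ, var z)) : τ = f z := by
  induction t generalizing σ l with
  | var y =>
    cases l with
    | nil =>
      simp only [nodeAt_nil, Option.some.injEq, Prod.mk.injEq, var.injEq] at hl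
      obtain ⟨rfl, rfl⟩ := hl
      exact ht
    | cons k l => simp at hl
  | top => cases l <;> simp at hl
  | bot => cases l <;> simp at hl
  | inf a b iha ihb =>
    cases l with
    | nil => simp at hl
    | cons k l =>
      simp only [nodeAt_inf_cons] at hl
      split_ifs at hl
      exacts [iha ht.1 hl, ihb ht.2 hl]
  | sup a b iha ihb =>
    cases l with
    | nil => simp at hl
    | cons k l =>
      simp only [nodeAt_sup_cons] at hl
      split_ifs at hl
      exacts [iha ht.1 hl, ihb ht.2 hl]
  | op h args ih =>
    cases l with
    | nil => simp at hl
    | cons k l =>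
      simp only [nodeAt_op_cons] at hl
      split_ifs at hl
      exact ih _ (ht _) hl

theorem VarsIn.mem {E : V → Prop} {t : Trm S V} (ht : t.VarsIn E) {σ : Bool}
    {l : List ℕ} {τ : Bool} {z : V} (hl : t.nodeAt σ l = some (τ, var z)) : E z := by
  induction t generalizing σ l with
  | var y =>
    cases l with
    | nil =>
      simp only [nodeAt_nil, Option.some.injEq, Prod.mk.injEq, var.injEq] at hl
      obtain ⟨rfl, rfl⟩ := hl
      exact ht
    | cons k l => simp at hl
  | top => cases l <;> simp at hl
  | bot => cases l <;> simp at hl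
  | inf a b iha ihb =>
    cases l with
    | nil => simp at hl
    | cons k l =>
      simp only [nodeAt_inf_cons] at hl
      split_ifs at hl
      exacts [iha ht.1 hl, ihb ht.2 hl]
  | sup a b iha ihb =>
    cases l with
    | nil => simp at hl
    | cons k l =>
      simp only [nodeAt_sup_cons] at hl
      split_ifs at hl
      exacts [iha ht.1 hl, ihb ht.2 hl]
  | op h args ih =>
    cases l with
    | nil => simp at hl
    | cons k l =>
      simp only [nodeAt_op_cons] at hl
      split_ifs at hl
      exact ih _ (ht _) hl

theorem leafSign_not (f : V → Bool) (t : Trm S V) (σ : Bool) :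
    t.LeafSign f (!σ) ↔ t.LeafSign (fun x => !(f x)) σ := by
  induction t generalizing σ with
  | var y => simp only [LeafSign]; cases σ <;> cases f y <;> simp
  | top => rfl
  | bot => rfl
  | inf a b iha ihb => simp only [LeafSign, iha, ihb]
  | sup a b iha ihb => simp only [LeafSign, iha, ihb]
  | op h args ih =>
    simp only [LeafSign]
    refine forall_congr' fun k => ?_
    rw [← ih]
    cases σ <;> cases S.tp h k <;> rfl

theorem LeafSign.bind {g : V → Bool} {f : W → Bool} {t : Trm S V} {σ : Bool}
    (ht : t.LeafSign g σ) {r : V → Trm S W} (hr : ∀ y, (r y).LeafSign f (g y)) :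
    (t.bind r).LeafSign f σ := by
  induction t generalizing σ with
  | var y => have : σ = g y := ht; subst this; exact hr y
  | top => trivial
  | bot => trivial
  | inf a b iha ihb => exact ⟨iha ht.1, ihb ht.2⟩
  | sup a b iha ihb => exact ⟨iha ht.1, ihb ht.2⟩
  | op h args ih => exact fun k => ih k (ht k)

theorem varsIn_bind {E : W → Prop} {r : V → Trm S W} (hr : ∀ y, (r y).VarsIn E) (t : Trm S V) :
    (t.bind r).VarsIn E := by
  induction t with
  | var y => exact hr y
  | top => trivial
  | bot => trivial
  | inf a b iha ihb => exact ⟨iha, ihb⟩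
  | sup a b iha ihb => exact ⟨iha, ihb⟩
  | op h args ih => exact ih

theorem VarsIn.eval_congr {A : Type u} [CompleteLattice A]
    {I : (h : S.Op) → (Fin (S.arity h) → A) → A} {E : V → Prop} {t : Trm S V} (ht : t.VarsIn E)
    {x y : V → A} (hxy : ∀ z, E z → x z = y z) : t.eval I x = t.eval I y := by
  induction t with
  | var z => exact hxy z ht
  | top => rfl
  | bot => rfl
  | inf a b iha ihb => simp [eval, iha ht.1, ihb ht.2]
  | sup a b iha ihb => simp [eval, iha ht.1, ihb ht.2]
  | op h args ih => simp only [eval]; congr 1; funext k; exact ih k (ht k)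

theorem eval_update_of_count_eq_zero [DecidableEq V] {A : Type u} [CompleteLattice A]
    {I : (h : S.Op) → (Fin (S.arity h) → A) → A} {t : Trm S V} {i : V} (ht : t.count i = 0)
    (z : V → A) (a : A) : t.eval I (Function.update z i a) = t.eval I z := by
  induction t with
  | var y =>
    have : y ≠ i := by intro e; simp [count, e] at ht
    simp [eval, this]
  | top => rfl
  | bot => rfl
  | inf s t ihs iht =>
    simp only [count, Nat.add_eq_zero_iff] at ht
    simp [eval, ihs ht.1, iht ht.2]
  | sup s t ihs iht =>
    simp only [count, Nat.add_eq_zero_iff] at ht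
    simp [eval, ihs ht.1, iht ht.2]
  | op h args ih =>
    simp only [count, Finset.sum_eq_zero_iff, Finset.mem_univ, true_implies] at ht
    simp only [eval]; congr 1; funext k; exact ih k (ht k)

/-- A definite skeleton is residuated in a variable that occurs exactly once. -/
theorem Skel.residuated [DecidableEq V] {A : Type u} [CompleteLattice A]
    {I : (h : S.Op) → (Fin (S.arity h) → A) → A} (hI : Residuated I) {t : Trm S V} {σ : Bool}
    (ht : t.Skel true σ) {i : V} (hi : t.count i = 1) {f : V → Bool} (hf : t.LeafSign f σ)
    (z : V → A) (b : A) :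
    ∃ r, ∀ a, SgLE σ (t.eval I (Function.update z i a)) b ↔ SgLE (f i) a r := by
  induction t generalizing σ b with
  | var y =>
    have : y = i := by by_contra e; simp [count, e] at hi
    subst this
    have hσ : σ = f y := hf
    exact ⟨b, fun a => by simp [eval, hσ]⟩
  | top => simp [count] at hi
  | bot => simp [count] at hi
  | inf s t _ _ => exact absurd ht.2.1 (by simp)
  | sup s t _ _ => exact absurd ht.2.1 (by simp)
  | op h args ih =>
    obtain ⟨k, -, hk⟩ : ∃ k ∈ Finset.univ, (args k).count i ≠ 0 :=
      Finset.exists_ne_zero_of_sum_ne_zero (by simp only [count] at hi; omega)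
    have hsum := Finset.add_sum_erase Finset.univ (fun j => (args j).count i) (Finset.mem_univ k)
    simp only [count] at hi
    rw [hi] at hsum
    have hk1 : (args k).count i = 1 := by omega
    have hrest : ∀ j, j ≠ k → (args j).count i = 0 := by
      have : ∑ j ∈ Finset.univ.erase k, (args j).count i = 0 := by omega
      intro j hj
      exact Finset.sum_eq_zero_iff.1 this j (by simp [hj])
    obtain ⟨r, hr⟩ := hI h k (fun j => (args j).eval I z) b
    obtain ⟨r', hr'⟩ := ih k (ht.2 k) hk1 (hf k) r
    refine ⟨r', fun a => ?_⟩
    have heq : (fun j => (args j).eval I (Function.update z i a)) =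
        Function.update (fun j => (args j).eval I z) k
          ((args k).eval I (Function.update z i a)) := by
      funext j
      by_cases hj : j = k
      · subst hj; simp
      · simp [hj, eval_update_of_count_eq_zero (hrest j hj)]
    have hσ : S.isF h = σ := ht.1
    rw [← hr', ← hσ, ← hr]
    simp only [eval, heq]

end General

end Trm

/-! ### Truth of inverse disjuncts and of pre-inverse correspondents -/

namespace PerfectLE

variable {S : LESig.{v}} (A : PerfectLE.{u} S)

theorem sat_allL (xs : List PureVar) (a : FO S) (x : PureVar → A.carrier) :
    A.Sat x (FO.allL xs a) ↔ ∀ y : PureVar → A.carrier, (∀ v ∉ xs, y v = x v) →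
      (∀ v ∈ xs, A.InRange v (y v)) → A.Sat y a := by
  induction xs generalizing x with
  | nil =>
    simp only [FO.allL, List.foldr_nil]
    constructor
    · intro h y hy _
      rwa [show y = x from funext fun v => hy v (by simp)]
    · intro h
      exact h x (by simp) (by simp)
  | cons v xs ih =>
    change (∀ c, A.InRange v c → A.Sat (Function.update x v c) (FO.allL xs a)) ↔ _
    simp only [ih]
    constructor
    · intro h y hy hr
      refine h (y v) (hr v (by simp)) y (fun w hw => ?_) fun w hw => hr w (by simp [hw])
      by_cases e : w = v
      · subst e; simp
      · simpa [e] using hy w (by simp [e, hw])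
    · intro h c hc y hy hr
      refine h y (fun w hw => ?_) fun w hw => ?_
      · simp only [List.mem_cons, not_or] at hw
        simpa [hw.1] using hy w hw.2
      · by_cases hw' : w ∈ xs
        · exact hr w hw'
        · obtain rfl : w = v := by simpa [hw'] using hw
          simpa [hy w hw'] using hc

theorem sat_exL (xs : List PureVar) (a : FO S) (x : PureVar → A.carrier) :
    A.Sat x (FO.exL xs a) ↔ ∃ y : PureVar → A.carrier, (∀ v ∉ xs, y v = x v) ∧
      (∀ v ∈ xs, A.InRange v (y v)) ∧ A.Sat y a := by
  have key : A.Sat x (FO.exL xs a) ↔ ¬ A.Sat x (FO.allL xs (FO.neg a)) := by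
    induction xs generalizing x with
    | nil => exact not_not.symm
    | cons v xs ih =>
      change (∃ c, A.InRange v c ∧ A.Sat (Function.update x v c) (FO.exL xs a)) ↔
        ¬ ∀ c, A.InRange v c → A.Sat (Function.update x v c) (FO.allL xs (FO.neg a))
      simp only [ih, not_forall, exists_prop]
  rw [key, sat_allL]
  simp only [not_forall, exists_prop, Sat, not_not]

theorem sat_orThen (as : List (FO S)) (c : FO S) (x : PureVar → A.carrier) :
    A.Sat x (FO.orThen as c) ↔ (∃ a ∈ as, A.Sat x a) ∨ A.Sat x c := by
  induction as with
  | nil => simp [FO.orThen]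
  | cons a as ih =>
    change (A.Sat x a ∨ A.Sat x (FO.orThen as c)) ↔ _
    rw [ih]; simp [or_assoc]

theorem sat_andThen (as : List (FO S)) (c : FO S) (x : PureVar → A.carrier) :
    A.Sat x (FO.andThen as c) ↔ (∀ a ∈ as, A.Sat x a) ∧ A.Sat x c := by
  induction as with
  | nil => simp [FO.andThen]
  | cons a as ih =>
    change (A.Sat x a ∧ A.Sat x (FO.andThen as c)) ↔ _
    rw [ih]; simp [and_assoc]

theorem sat_impThen (as : List (FO S)) (c : FO S) (x : PureVar → A.carrier) :
    A.Sat x (FO.impThen as c) ↔ ((∀ a ∈ as, A.Sat x a) → A.Sat x c) := by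
  cases as with
  | nil => simp [FO.impThen]
  | cons a as =>
    change (A.Sat x (FO.andThen _ _) → A.Sat x c) ↔ _
    rw [sat_andThen]
    refine imp_congr_left ?_
    conv_rhs => rw [← List.dropLast_append_getLast (List.cons_ne_nil a as)]
    simp only [List.mem_append, List.mem_singleton, or_imp, forall_and, forall_eq]

theorem sat_bound (v : PureVar) (ξ : Trm S.star PureVar) (x : PureVar → A.carrier) :
    A.Sat x (FO.bound v ξ) ↔ SgLE v.isNom (x v) (ξ.eval A.opStar x) := by
  cases v <;> simp [FO.bound, PureVar.isNom, Sat, Trm.eval]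

theorem sgLE_eval_meetFor (v : PureVar) (ξ ζ : Trm S.star PureVar) (x : PureVar → A.carrier)
    (a : A.carrier) : SgLE v.isNom a ((meetFor v ξ ζ).eval A.opStar x) ↔
      SgLE v.isNom a (ξ.eval A.opStar x) ∧ SgLE v.isNom a (ζ.eval A.opStar x) := by
  cases v <;> simp [meetFor, PureVar.isNom, Trm.eval]

end PerfectLE

section InvDisj

variable {S : LESig.{v}} {E : PureVar → Prop}

theorem meetFor_cases (v : PureVar) (ξ ζ : Trm S.star PureVar) :
    (v.isNom = true ∧ meetFor v ξ ζ = .inf ξ ζ) ∨ (v.isNom = false ∧ meetFor v ξ ζ = .sup ξ ζ) := by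
  cases v <;> simp [meetFor, PureVar.isNom]

theorem InvDisj.varsIn {pol : Bool} {v : PureVar} {θ : FO S} {ξ : Trm S.star PureVar}
    (h : InvDisj E pol v θ ξ) : ξ.VarsIn E := by
  induction h with
  | basePos v ψ _ h _ => exact h
  | baseNeg v ψ _ h _ => exact h
  | conj v θ₁ θ₂ ξ₁ ξ₂ _ _ h₁ h₂ =>
    rcases meetFor_cases v ξ₁ ξ₂ with ⟨-, e⟩ | ⟨-, e⟩ <;> rw [e] <;> exact ⟨h₁, h₂⟩
  | disj v θ₁ θ₂ ξ₁ ξ₂ _ _ h₁ h₂ =>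
    rcases meetFor_cases v ξ₁ ξ₂ with ⟨-, e⟩ | ⟨-, e⟩ <;> rw [e] <;> exact ⟨h₁, h₂⟩
  | quantPos v n us θ ξ ψ _ _ _ _ _ _ _ ih => exact Trm.varsIn_bind ih ψ
  | quantNeg v n us θ ξ ψ _ _ _ _ _ _ _ ih => exact Trm.varsIn_bind ih ψ

theorem InvDisj.leafSign {pol : Bool} {v : PureVar} {θ : FO S} {ξ : Trm S.star PureVar}
    (h : InvDisj E pol v θ ξ) : ξ.LeafSign (fun x => pol ^^ x.isNom) (!v.isNom) := by
  induction h with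
  | basePos v ψ _ _ h => simpa using h
  | baseNeg v ψ _ _ h => simpa using h
  | conj v θ₁ θ₂ ξ₁ ξ₂ _ _ h₁ h₂ =>
    rcases meetFor_cases v ξ₁ ξ₂ with ⟨-, e⟩ | ⟨-, e⟩ <;> rw [e] <;> exact ⟨h₁, h₂⟩
  | disj v θ₁ θ₂ ξ₁ ξ₂ _ _ h₁ h₂ =>
    rcases meetFor_cases v ξ₁ ξ₂ with ⟨-, e⟩ | ⟨-, e⟩ <;> rw [e] <;> exact ⟨h₁, h₂⟩
  | quantPos v n us θ ξ ψ _ _ _ _ hs _ _ ih =>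
    refine hs.bind fun i => ?_
    have := ih i
    rw [Trm.leafSign_not] at this
    simpa using this
  | quantNeg v n us θ ξ ψ _ _ _ _ hs _ _ ih =>
    refine hs.bind fun i => ?_
    have := ih i
    rw [Trm.leafSign_not] at this
    simpa using this

/-- The inequality `v ≤ ψ(ξ)`, or its dual, in terms of the generators below the values of the
`ξ i`. -/
theorem sgLE_eval_bind_iff (A : PerfectLE.{u} S) {v : PureVar} {n : ℕ} {us : Fin n → PureVar}
    {ξ : Fin n → Trm S.star PureVar} {ψ : Trm S.star (Fin n)} (hinj : Function.Injective us)
    (hus : ∀ i, us i ≠ v ∧ ¬ E (us i)) (hsk : ψ.Skel true (!v.isNom))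
    (hc : ∀ i, ψ.count i = 1) (hs : ψ.LeafSign (fun i => (us i).isNom) (!v.isNom))
    (hξ : ∀ i, (ξ i).VarsIn E) (x : PureVar → A.carrier) :
    SgLE v.isNom (x v) ((ψ.bind ξ).eval A.opStar x) ↔
      ∀ y : PureVar → A.carrier, (∀ w ∉ List.ofFn us, y w = x w) →
        (∀ w ∈ List.ofFn us, A.InRange w (y w)) →
        (∀ i, SgLE (us i).isNom (y (us i)) ((ξ i).eval A.opStar y)) →
        SgLE v.isNom (y v) ((ψ.rename us).eval A.opStar y) := by
  classical
  have hE : ∀ y : PureVar → A.carrier, (∀ w ∉ List.ofFn us, y w = x w) →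
      y v = x v ∧ ∀ i, (ξ i).eval A.opStar y = (ξ i).eval A.opStar x := by
    intro y hy
    refine ⟨hy v ?_, fun i => (hξ i).eval_congr fun w hw => hy w ?_⟩
    · rw [List.mem_ofFn]; rintro ⟨i, hi⟩; exact (hus i).1 hi
    · rw [List.mem_ofFn]; rintro ⟨i, rfl⟩; exact (hus i).2 hw
  rw [Trm.eval_bind, A.iff_forall_gen (fun i => (us i).isNom)
    (fun c => SgLE v.isNom (x v) (ψ.eval A.opStar c))]
  · constructor
    · intro h y hy hr hξy
      obtain ⟨hv, hξe⟩ := hE y hy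
      rw [hv, Trm.eval_rename]
      refine h _ fun i => ⟨?_, ?_⟩
      · rw [← A.inRange_iff]; exact hr _ (by simp [List.mem_ofFn])
      · rw [← hξe]; exact hξy i
    · intro h c hc
      let y : PureVar → A.carrier := Function.extend us c x
      have hyu : ∀ i, y (us i) = c i := fun i => hinj.extend_apply _ _ _
      have hy : ∀ w ∉ List.ofFn us, y w = x w := by
        intro w hw
        refine Function.extend_apply' _ _ _ ?_
        rwa [List.mem_ofFn] at hw
      obtain ⟨hv, hξe⟩ := hE y hy
      have := h y hy ?_ ?_
      · rw [hv, Trm.eval_rename] at this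
        simpa only [hyu] using this
      · intro w hw
        rw [List.mem_ofFn] at hw
        obtain ⟨i, rfl⟩ := hw
        rw [A.inRange_iff, hyu]
        exact (hc i).1
      · intro i
        rw [hξe, hyu]
        exact (hc i).2
  · intro z i
    obtain ⟨r, hr⟩ := hsk.residuated A.residuated_opStar (hc i) hs z (x v)
    exact ⟨r, fun a => by rw [← hr a, sgLE_not]⟩

/-- An inverse disjunct says the same as the inequality, or the negated inequality, between its
main variable and its compaction. -/
theorem InvDisj.sat_iff (A : PerfectLE.{u} S) {pol : Bool} {v : PureVar} {θ : FO S}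
    {ξ : Trm S.star PureVar} (h : InvDisj E pol v θ ξ) (x : PureVar → A.carrier) :
    A.Sat x θ ↔ if pol = true then SgLE v.isNom (x v) (ξ.eval A.opStar x)
      else ¬ SgLE v.isNom (x v) (ξ.eval A.opStar x) := by
  induction h generalizing x with
  | basePos v ψ _ _ _ => simp [A.sat_bound]
  | baseNeg v ψ _ _ _ => simp [PerfectLE.Sat, A.sat_bound]
  | conj v θ₁ θ₂ ξ₁ ξ₂ _ _ h₁ h₂ => simp [PerfectLE.Sat, h₁, h₂, A.sgLE_eval_meetFor]
  | disj v θ₁ θ₂ ξ₁ ξ₂ _ _ h₁ h₂ =>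
    simp [PerfectLE.Sat, h₁, h₂, A.sgLE_eval_meetFor, -not_and, not_and_or]
  | quantPos v n us θ ξ ψ hinj hus hsk hc hs hθ _ ih =>
    rw [if_pos rfl, sgLE_eval_bind_iff A hinj hus hsk hc hs (fun i => (hθ i).varsIn), A.sat_allL]
    refine forall_congr' fun y => forall_congr' fun _ => forall_congr' fun _ => ?_
    have hor : A.Sat y (FO.orThen (List.ofFn fun i : Fin n => θ i.castSucc) (θ (Fin.last n))) ↔
        ∃ i, A.Sat y (θ i) := by
      rw [A.sat_orThen]
      constructor
      · rintro (⟨a, ha, hs⟩ | hs)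
        · rw [List.mem_ofFn] at ha
          obtain ⟨i, rfl⟩ := ha
          exact ⟨_, hs⟩
        · exact ⟨_, hs⟩
      · rintro ⟨i, hi⟩
        induction i using Fin.lastCases with
        | last => exact Or.inr hi
        | cast i => exact Or.inl ⟨_, by rw [List.mem_ofFn]; exact ⟨i, rfl⟩, hi⟩
    change (¬ A.Sat y (FO.bound v (ψ.rename us)) → A.Sat y (FO.orThen _ _)) ↔ _
    rw [hor, A.sat_bound]
    simp only [ih, Bool.false_eq_true, if_false]
    rw [not_imp_comm, not_exists]
    simp only [not_not]
  | quantNeg v n us θ ξ ψ hinj hus hsk hc hs hθ _ ih =>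
    rw [if_neg (by simp), sgLE_eval_bind_iff A hinj hus hsk hc hs (fun i => (hθ i).varsIn),
      A.sat_exL]
    simp only [not_forall, exists_prop]
    refine exists_congr fun y => and_congr_right fun _ => and_congr_right fun _ => ?_
    rw [A.sat_andThen]
    refine and_congr ?_ (not_congr (A.sat_bound _ _ _))
    simp only [List.forall_mem_ofFn_iff, ih, if_true]

end InvDisj

namespace PreInverse

variable {S : LESig.{v}} (D : PreInverse S)

/-- The meaning of both shapes of a pre-inverse correspondent. -/
def Truth (A : PerfectLE.{u} S) : Prop :=
  ∀ y : PureVar → A.carrier, (∀ k, A.InRange (D.us k) (y (D.us k))) →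
    (∀ k, D.con k = true → SgLE (D.us k).isNom (y (D.us k)) ((D.ξ k).eval A.opStar y)) →
    D.φ.eval A.opStar (fun k => y (D.us k)) ≤ D.ψ.eval A.opStar fun k => y (D.us k)

theorem sat_θ_iff (A : PerfectLE.{u} S) (y : PureVar → A.carrier) {k : Fin D.n}
    (hk : D.con k = true) :
    A.Sat y (D.θ k) ↔ ¬ SgLE (D.us k).isNom (y (D.us k)) ((D.ξ k).eval A.opStar y) := by
  simpa using (D.θ_inv k hk).sat_iff A y

theorem models_allL_iff (A : PerfectLE.{u} S) (a : FO S)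
    (ha : ∀ y : PureVar → A.carrier, A.Sat y a ↔
      ((∀ k, D.con k = true → SgLE (D.us k).isNom (y (D.us k)) ((D.ξ k).eval A.opStar y)) →
        D.φ.eval A.opStar (fun k => y (D.us k)) ≤ D.ψ.eval A.opStar fun k => y (D.us k))) :
    A.Models (FO.allL (List.ofFn D.us) a) ↔ D.Truth A := by
  simp only [PerfectLE.Models, A.sat_allL, ha]
  constructor
  · intro h y hy
    refine h y y (fun _ _ => rfl) fun w hw => ?_
    rw [List.mem_ofFn] at hw
    obtain ⟨k, rfl⟩ := hw
    exact hy k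
  · intro h _ y _ hy
    exact h y fun k => hy _ (by simp [List.mem_ofFn])

theorem models_formula_iff (A : PerfectLE.{u} S) : A.Models D.formula ↔ D.Truth A := by
  refine D.models_allL_iff A _ fun y => ?_
  rw [A.sat_orThen]
  simp only [PerfectLE.Sat, Trm.eval_rename]
  rw [or_iff_not_imp_left]
  refine imp_congr_left ?_
  simp only [List.mem_map, conList, List.mem_filter, List.mem_finRange, true_and, not_exists,
    not_and, forall_exists_index, and_imp, forall_apply_eq_imp_iff₂]
  exact forall_congr' fun k => forall_congr' fun hk => by rw [D.sat_θ_iff A y hk, not_not]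

theorem models_formulaImp_iff (A : PerfectLE.{u} S) : A.Models D.formulaImp ↔ D.Truth A := by
  refine D.models_allL_iff A _ fun y => ?_
  rw [A.sat_impThen]
  simp only [PerfectLE.Sat, Trm.eval_rename]
  refine imp_congr_left ?_
  simp only [List.mem_map, conList, List.mem_filter, List.mem_finRange, true_and,
    forall_exists_index, and_imp, forall_apply_eq_imp_iff₂, PerfectLE.Sat]
  exact forall_congr' fun k => forall_congr' fun hk => by rw [D.sat_θ_iff A y hk, not_not]

theorem sgLE_eval_repl (A : PerfectLE.{u} S) (x : PureVar → A.carrier) (k : Fin D.n)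
    (a : A.carrier) : SgLE (D.us k).isNom a ((D.repl k).eval A.opStar x) ↔
      (D.con k = true → SgLE (D.us k).isNom a ((D.ξ k).eval A.opStar x)) ∧
      (D.free k = true → SgLE (D.us k).isNom a (x (D.us k))) := by
  have := D.cover k
  cases hc : D.con k <;> cases hf : D.free k <;>
    simp_all [repl, A.sgLE_eval_meetFor, Trm.eval]

theorem toProp_injective : Function.Injective PureVar.toProp := by
  intro a b h
  cases a <;> cases b <;> simp only [PureVar.toProp] at h <;> first | omega | (congr 1; omega)

theorem validStar_iff_forall (A : PerfectLE.{u} S) : A.ValidStar D.lhs D.rhs ↔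
    ∀ x : PureVar → A.carrier,
      D.φ.eval A.opStar (fun k => (D.repl k).eval A.opStar x) ≤
        D.ψ.eval A.opStar fun k => (D.repl k).eval A.opStar x := by
  simp only [PerfectLE.ValidStar, lhs, rhs, Trm.eval_rename, Trm.eval_bind]
  constructor
  · intro h x
    have := h (Function.extend PureVar.toProp x fun _ => ⊥)
    simpa only [toProp_injective.extend_apply] using this
  · exact fun h x => h fun v => x v.toProp

/-- A pre-inverse correspondent is equivalent to its associated inequality: `φ ≤ ψ` may be tested
on generators, and the generators themselves are the least possible values (in the signed order)
of the free variables, on which the compactions depend monotonically. -/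
theorem truth_iff_validStar (A : PerfectLE.{u} S) : D.Truth A ↔ A.ValidStar D.lhs D.rhs := by
  rw [validStar_iff_forall]
  have hgen := fun x : PureVar → A.carrier => A.iff_forall_gen (fun k => (D.us k).isNom)
    (fun c => D.φ.eval A.opStar c ≤ D.ψ.eval A.opStar c) (fun z i => by
      have h1 := D.once i
      rcases Nat.eq_zero_or_pos (D.φ.count i) with h0 | h0
      · obtain ⟨r, hr⟩ := D.ψ_skel.residuated A.residuated_opStar (i := i) (by omega) D.ψ_sign z
          (D.φ.eval A.opStar z)
        refine ⟨r, fun a => ?_⟩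
        rw [← hr a, Trm.eval_update_of_count_eq_zero h0]
        rfl
      · obtain ⟨r, hr⟩ := D.φ_skel.residuated A.residuated_opStar (i := i) (by omega) D.φ_sign z
          (D.ψ.eval A.opStar z)
        refine ⟨r, fun a => ?_⟩
        rw [← hr a, Trm.eval_update_of_count_eq_zero (t := D.ψ) (by omega)]
        rfl) (fun k => (D.repl k).eval A.opStar x)
  simp only [hgen, sgLE_eval_repl]
  constructor
  · intro h x c hc
    let y : PureVar → A.carrier := Function.extend D.us c x
    have hyu : ∀ i, y (D.us i) = c i := fun i => D.us_inj.extend_apply _ _ _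
    have := h y (fun k => by rw [A.inRange_iff, hyu]; exact (hc k).1) fun k hk => ?_
    · simpa only [hyu] using this
    · rw [hyu]
      refine ((hc k).2.1 hk).trans ?_
      have hinv := D.θ_inv k hk
      have hs := hinv.leafSign
      simp only [Bool.false_xor] at hs
      rw [← sgLE_not]
      refine Trm.sgLE_eval A.residuated_opStar _ _ fun l τ w hl => ?_
      rw [hs.sign_eq hl]
      obtain ⟨i, hi, rfl⟩ := hinv.varsIn.mem hl
      rw [hyu]
      exact (hc i).2.2 hi
  · intro h y hy hk
    exact h y (fun k => y (D.us k)) fun k =>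
      ⟨(A.inRange_iff _ _).1 (hy k), hk k, fun _ => SgLE.refl _ _⟩

end PreInverse

/-! ### Elimination of uniform variables -/

namespace Trm

variable {S : LESig.{v}} {V W X : Type}

theorem bind_bind (f : V → Trm S W) (g : W → Trm S X) (t : Trm S V) :
    (t.bind f).bind g = t.bind fun x => (f x).bind g := by
  induction t with
  | var y => rfl
  | top => rfl
  | bot => rfl
  | inf a b iha ihb => simp [bind, iha, ihb]
  | sup a b iha ihb => simp [bind, iha, ihb]
  | op h args ih => simp [bind, ih]

theorem nodeAt_bind_of_eq_some (f : V → Trm S W) {t : Trm S V} {σ τ : Bool} {p : List ℕ}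
    {a : Trm S V} (h : t.nodeAt σ p = some (τ, a)) :
    (t.bind f).nodeAt σ p = some (τ, a.bind f) := by
  induction t generalizing σ p with
  | var y => cases p <;> simp at h; obtain ⟨rfl, rfl⟩ := h; simp
  | top => cases p <;> simp at h; obtain ⟨rfl, rfl⟩ := h; simp
  | bot => cases p <;> simp at h; obtain ⟨rfl, rfl⟩ := h; simp
  | inf a b iha ihb =>
    cases p with
    | nil => simp at h; obtain ⟨rfl, rfl⟩ := h; simp
    | cons k p =>
      simp only [nodeAt_inf_cons, bind] at h ⊢
      split_ifs at h ⊢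
      exacts [iha h, ihb h]
  | sup a b iha ihb =>
    cases p with
    | nil => simp at h; obtain ⟨rfl, rfl⟩ := h; simp
    | cons k p =>
      simp only [nodeAt_sup_cons, bind] at h ⊢
      split_ifs at h ⊢
      exacts [iha h, ihb h]
  | op o args ih =>
    cases p with
    | nil => simp at h; obtain ⟨rfl, rfl⟩ := h; simp
    | cons k p =>
      simp only [nodeAt_op_cons, bind] at h ⊢
      split_ifs at h ⊢
      exact ih _ h

/-- Substituting leaves for variables does not change the shape of the tree. -/
theorem nodeAt_bind {f : V → Trm S W} (hf : ∀ x k, (f x).child k = none) (t : Trm S V)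
    (σ : Bool) (p : List ℕ) :
    (t.bind f).nodeAt σ p = (t.nodeAt σ p).map fun nd => (nd.1, nd.2.bind f) := by
  have hchild : ∀ (t : Trm S V) (k : ℕ),
      (t.bind f).child k = (t.child k).map fun nd => (nd.1, nd.2.bind f) := by
    intro t k
    cases t with
    | var y => exact hf y k
    | top => rfl
    | bot => rfl
    | inf a b => simp only [bind, child]; split_ifs <;> rfl
    | sup a b => simp only [bind, child]; split_ifs <;> rfl
    | op h args => simp only [bind, child]; split_ifs <;> rfl
  induction p generalizing σ t with
  | nil => rfl
  | cons k p ih =>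
    simp only [nodeAt, hchild]
    cases t.child k with
    | none => rfl
    | some c => exact ih _ _

theorem exists_leaf_of_count_ne_zero [DecidableEq V] {t : Trm S V} {x : V} (h : t.count x ≠ 0)
    (σ : Bool) : ∃ l τ, t.nodeAt σ l = some (τ, var x) := by
  induction t generalizing σ with
  | var y =>
    have : y = x := by by_contra e; simp [count, e] at h
    subst this
    exact ⟨[], σ, rfl⟩
  | top => simp [count] at h
  | bot => simp [count] at h
  | inf a b iha ihb =>
    by_cases ha : a.count x = 0
    · obtain ⟨l, τ, hl⟩ := ihb (by simpa [count, ha] using h) σ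
      exact ⟨1 :: l, τ, by simpa using hl⟩
    · obtain ⟨l, τ, hl⟩ := iha ha σ
      exact ⟨0 :: l, τ, by simpa using hl⟩
  | sup a b iha ihb =>
    by_cases ha : a.count x = 0
    · obtain ⟨l, τ, hl⟩ := ihb (by simpa [count, ha] using h) σ
      exact ⟨1 :: l, τ, by simpa using hl⟩
    · obtain ⟨l, τ, hl⟩ := iha ha σ
      exact ⟨0 :: l, τ, by simpa using hl⟩
  | op o args ih =>
    obtain ⟨k, -, hk⟩ := Finset.exists_ne_zero_of_sum_ne_zero h
    obtain ⟨l, τ, hl⟩ := ih k hk (σ == S.tp o k)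
    exact ⟨k.val :: l, τ, by rw [nodeAt_op_fin]; exact hl⟩

end Trm

section Uniform

variable {S : LESig.{v}} (s t : Trm S ℕ)

open Classical in
/-- The substitution that removes the uniform variables of `s ≤ t`: a variable with only positive
occurrences is replaced by `⊤`, one with only negative occurrences by `⊥`. -/
noncomputable def elimUniform (x : ℕ) : Trm S ℕ :=
  if ∃ l, IsLeaf s t l true x then
    if ∃ l, IsLeaf s t l false x then .var x else .top
  else .bot

variable {s t}

theorem elimUniform_cases (x : ℕ) : elimUniform s t x = .var x ∨ elimUniform s t x = .top ∨
    elimUniform s t x = .bot := by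
  unfold elimUniform
  split_ifs <;> simp

theorem elimUniform_eq_var_iff {x y : ℕ} : elimUniform s t x = .var y ↔
    x = y ∧ ∀ σ, ∃ l, IsLeaf s t l σ x := by
  unfold elimUniform
  rw [Bool.forall_bool]
  split_ifs <;> simp_all

theorem elimUniform_eq_var_of_leaves {x : ℕ} {σ : Bool} {l l' : List ℕ} (h : IsLeaf s t l σ x)
    (h' : IsLeaf s t l' (!σ) x) : elimUniform s t x = .var x := by
  refine elimUniform_eq_var_iff.2 ⟨rfl, fun τ => ?_⟩
  cases σ <;> cases τ <;> exact ⟨_, by first | exact h | exact h'⟩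

theorem node_elimUniform (p : List ℕ) :
    node (s.bind (elimUniform s t)) (t.bind (elimUniform s t)) p =
      (node s t p).map fun nd => (nd.1, nd.2.bind (elimUniform s t)) := by
  have hf : ∀ x k, (elimUniform s t x).child k = none := by
    intro x k
    rcases elimUniform_cases (s := s) (t := t) x with e | e | e <;> rw [e] <;> rfl
  rcases p with _ | ⟨_ | _ | k, p⟩
  · rfl
  · exact Trm.nodeAt_bind hf _ _ _
  · exact Trm.nodeAt_bind hf _ _ _
  · rfl

theorem isLeaf_elimUniform_iff {l : List ℕ} {σ : Bool} {x : ℕ} :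
    IsLeaf (s.bind (elimUniform s t)) (t.bind (elimUniform s t)) l σ x ↔
      IsLeaf s t l σ x ∧ elimUniform s t x = .var x := by
  unfold IsLeaf
  rw [node_elimUniform]
  constructor
  · intro h
    obtain ⟨⟨τ, a⟩, ha, h2⟩ := Option.map_eq_some_iff.1 h
    simp only [Prod.mk.injEq] at h2
    obtain ⟨rfl, h2⟩ := h2
    cases a with
    | var y =>
      have := (elimUniform_eq_var_iff.1 h2).1
      subst this
      exact ⟨ha, h2⟩
    | _ => simp [Trm.bind] at h2
  · rintro ⟨h, h2⟩
    rw [h]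
    simp [Trm.bind, h2]

theorem noUniform_elimUniform :
    NoUniform (s.bind (elimUniform s t)) (t.bind (elimUniform s t)) := by
  intro l σ x h
  obtain ⟨-, h2⟩ := isLeaf_elimUniform_iff.1 h
  obtain ⟨l', hl'⟩ := (elimUniform_eq_var_iff.1 h2).2 (!σ)
  exact ⟨l', isLeaf_elimUniform_iff.2 ⟨hl', h2⟩⟩

theorem valid_elimUniform_iff {A : Type u} [CompleteLattice A]
    {I : (h : S.Op) → (Fin (S.arity h) → A) → A} (hI : Residuated I) :
    (∀ x, s.eval I x ≤ t.eval I x) ↔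
      ∀ x, (s.bind (elimUniform s t)).eval I x ≤ (t.bind (elimUniform s t)).eval I x := by
  simp only [Trm.eval_bind]
  refine ⟨fun h x => h _, fun h x => ?_⟩
  -- each leaf can only grow in the signed order, as a leaf replaced by `⊤` or `⊥` is uniform
  have key : ∀ p τ z, IsLeaf s t p τ z → SgLE τ (x z) ((elimUniform s t z).eval I x) := by
    intro p τ z hz
    unfold elimUniform
    cases τ
    · have h1 : ∃ l, IsLeaf s t l false z := ⟨p, hz⟩
      rw [if_pos h1]
      split_ifs
      · exact SgLE.refl _ _
      · exact bot_le (a := x z)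
    · have h1 : ∃ l, IsLeaf s t l true z := ⟨p, hz⟩
      rw [if_pos h1]
      split_ifs
      · exact SgLE.refl _ _
      · exact le_top (a := x z)
  have h1 := Trm.sgLE_eval hI s true fun l τ z hl => key (0 :: l) τ z hl
  have h2 := Trm.sgLE_eval hI t false fun l τ z hl => key (1 :: l) τ z hl
  exact (le_trans h1 (h x)).trans h2

theorem exists_node_of_node_elimUniform {p : List ℕ} {σ : Bool} {a : Trm S ℕ}
    (h : node (s.bind (elimUniform s t)) (t.bind (elimUniform s t)) p = some (σ, a)) :
    ∃ b, node s t p = some (σ, b) ∧ a = b.bind (elimUniform s t) := by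
  rw [node_elimUniform] at h
  obtain ⟨⟨τ, b⟩, hb, h2⟩ := Option.map_eq_some_iff.1 h
  simp only [Prod.mk.injEq] at h2
  obtain ⟨rfl, rfl⟩ := h2
  exact ⟨b, hb, rfl⟩

theorem exists_op_of_node_elimUniform {p : List ℕ} {σ : Bool} {h : S.Op}
    {args : Fin (S.arity h) → Trm S ℕ}
    (hp : node (s.bind (elimUniform s t)) (t.bind (elimUniform s t)) p = some (σ, .op h args)) :
    ∃ args', node s t p = some (σ, .op h args') := by
  obtain ⟨b, hb, e⟩ := exists_node_of_node_elimUniform hp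
  cases b with
  | var y =>
    rcases elimUniform_cases (s := s) (t := t) y with e' | e' | e' <;> simp [Trm.bind, e'] at e
  | op h' args' =>
    simp only [Trm.bind, Trm.op.injEq] at e
    obtain ⟨rfl, -⟩ := e
    exact ⟨_, hb⟩
  | _ => simp [Trm.bind] at e

theorem srrNode_of_bind {σ : Bool} {b : Trm S ℕ}
    (h : SRRNode (σ, b.bind (elimUniform s t))) : SRRNode (σ, b) := by
  cases b with
  | var y =>
    rcases elimUniform_cases (s := s) (t := t) y with e | e | e <;>
      simp [Trm.bind, e, SRRNode] at h
  | _ => exact h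

theorem BranchShape.elimUniform {l : List ℕ} {a b : ℕ} (h : BranchShape s t l a b) :
    BranchShape (s.bind (elimUniform s t)) (t.bind (elimUniform s t)) l a b := by
  refine ⟨h.1, fun q nd hq hne hnd => ?_⟩
  obtain ⟨σ, c⟩ := nd
  obtain ⟨c, hc, rfl⟩ := exists_node_of_node_elimUniform hnd
  rcases h.2 q _ hq hne hc with h | h | h <;> cases c <;>
    first
      | exact Or.inl h
      | exact Or.inr (Or.inl h)
      | exact Or.inr (Or.inr h)
      | simp [DefSkelNode, MeetNode, DefPIANode] at h

theorem IsInductiveFor.elimUniform {ε : ℕ → Bool} {Ω : ℕ → ℕ → Prop}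
    (h : IsInductiveFor ε Ω s t) :
    IsInductiveFor ε Ω (s.bind (elimUniform s t)) (t.bind (elimUniform s t)) := by
  constructor
  · intro l x hl
    obtain ⟨a, b, hab⟩ := h.1 l x (isLeaf_elimUniform_iff.1 hl).1
    exact ⟨a, b, hab.elimUniform⟩
  · intro l x hl q nd hq hne hnd hsrr
    obtain ⟨σ, c⟩ := nd
    obtain ⟨c, hc, rfl⟩ := exists_node_of_node_elimUniform hnd
    have := h.2 l x (isLeaf_elimUniform_iff.1 hl).1 q _ hq hne hc (srrNode_of_bind hsrr)
    exact ⟨fun l' x' hl' hx' => this.1 l' x' hl' (isLeaf_elimUniform_iff.1 hx').1,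
      fun l' σ' y hl' hy => this.2 l' σ' y hl' (isLeaf_elimUniform_iff.1 hy).1⟩

end Uniform

section UniformCrypto

variable {S : LESig.{v}} {s t : Trm S.star ℕ}

/-- On the path from the root of a candidate for `MVTree(l)` to `l`, all nodes other than `l` are
definite PIA nodes. -/
theorem MVCandidate.exists_defPIANode {ε : ℕ → Bool} {Ω : ℕ → ℕ → Prop} {l r q : List ℕ}
    (h : MVCandidate ε Ω s t l r) (hr : r <+: q) (hq : q <+: l) (hne : q ≠ l) :
    ∃ nd, node s t q = some nd ∧ DefPIANode nd := by
  obtain ⟨w, rfl⟩ := hq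
  cases w with
  | nil => simp at hne
  | cons k w =>
    obtain ⟨σ, o, args, hn, hF, -⟩ := h.path q k hr ⟨w, by simp⟩
    exact ⟨_, hn, hF⟩

/-- If no uniform variable occurs below a definite PIA node, the elimination of uniform variables
preserves the conditions of crypto-inductivity, with the same trees `MVTree(l)`. -/
theorem IsCryptoFor.elimUniform {meets : Bool} {ε : ℕ → Bool} {Ω : ℕ → ℕ → Prop}
    (h : IsCryptoFor meets ε Ω s t)
    (hU : ∀ l σ x, IsLeaf s t l σ x → elimUniform s t x ≠ .var x → ∀ q nd, q <+: l →
      node s t q = some nd → ¬ DefPIANode nd) :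
    IsCryptoFor meets ε Ω (s.bind (elimUniform s t)) (t.bind (elimUniform s t)) where
  verySimple := by
    intro l x hl
    obtain ⟨a, ha, hm⟩ := h.verySimple l x (isLeaf_elimUniform_iff.1 hl).1
    exact ⟨a, ha.elimUniform, hm⟩
  critical := by
    intro l x hl q σ o args hq hn
    obtain ⟨args', hn'⟩ := exists_op_of_node_elimUniform hn
    exact h.critical l x (isLeaf_elimUniform_iff.1 hl).1 q σ o args' hq hn'
  strict := h.strict
  covered := by
    obtain ⟨M, hM, hcov⟩ := h.covered
    have hnc : ∀ l, IsNonCritical ε (s.bind (InvCorr.elimUniform s t))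
        (t.bind (InvCorr.elimUniform s t)) l → IsNonCritical ε s t l :=
      fun l ⟨x, hx⟩ => ⟨x, (isLeaf_elimUniform_iff.1 hx).1⟩
    refine ⟨M, fun l hl => ?_, fun q σ o args hn hb => ?_⟩
    · obtain ⟨⟨hc, hadm⟩, hmax⟩ := hM l (hnc l hl)
      refine ⟨⟨⟨hc.mem, ?_, ?_, ?_, ?_⟩, ?_⟩, ?_⟩
      · intro q k hq hk
        obtain ⟨σ, o, args, hn, hF, hcons⟩ := hc.path q k hq hk
        exact ⟨σ, o, _, by rw [node_elimUniform, hn]; rfl, hF, hcons⟩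
      · intro σ x hx l' τ y hl' hy
        exact hc.vars σ x (isLeaf_elimUniform_iff.1 hx).1 l' τ y hl' (isLeaf_elimUniform_iff.1 hy).1
      · intro l' y hl' hy
        exact hc.noncrit l' y hl' (isLeaf_elimUniform_iff.1 hy).1
      · intro σ o args hn
        obtain ⟨args', hn'⟩ := exists_op_of_node_elimUniform hn
        exact hc.topmost σ o args' hn'
      · intro l' hl'
        exact hadm l' (hnc l' hl')
      · intro r ⟨hr, hr'⟩
        by_cases hrl : r = l
        · rw [hrl]; exact hc.mem.1
        -- a larger candidate is topped by a definite PIA node, so it contains no uniform variable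
        obtain ⟨w, hw⟩ := hr.mem.1
        cases w with
        | nil => exact absurd (by simpa using hw) hrl
        | cons k w =>
        obtain ⟨σ, o, args, hn, hF, -⟩ := hr.path r k (List.prefix_refl r) ⟨w, by simp [hw]⟩
        obtain ⟨args', hn'⟩ := exists_op_of_node_elimUniform hn
        have hnu : ∀ l' τ y, r <+: l' → IsLeaf s t l' τ y →
            InvCorr.elimUniform s t y = .var y := by
          intro l' τ y hl' hy
          by_contra hne
          exact hU l' τ y hy hne r _ hl' hn' hF
        refine hmax r ⟨⟨hr.mem, ?_, ?_, ?_, ?_⟩, ?_⟩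
        · intro q k hq hk
          obtain ⟨σ, o, args, hn, hF, hcons⟩ := hr.path q k hq hk
          obtain ⟨args', hn'⟩ := exists_op_of_node_elimUniform hn
          exact ⟨σ, o, args', hn', hF, hcons⟩
        · intro σ x hx l' τ y hl' hy
          exact hr.vars σ x (isLeaf_elimUniform_iff.2 ⟨hx, hnu l σ x hr.mem.1 hx⟩) l' τ y hl'
            (isLeaf_elimUniform_iff.2 ⟨hy, hnu l' τ y hl' hy⟩)
        · intro l' y hl' hy
          exact hr.noncrit l' y hl' (isLeaf_elimUniform_iff.2 ⟨hy, hnu l' _ y hl' hy⟩)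
        · intro σ o args hn
          exact hr.topmost σ o _ (by rw [node_elimUniform, hn]; rfl)
        · rintro l' ⟨x, hx⟩ hlt ⟨hM', hrl'⟩
          exact hr' l' ⟨x, isLeaf_elimUniform_iff.2 ⟨hx, hnu l' _ x hrl' hx⟩⟩ hlt ⟨hM', hrl'⟩
    · obtain ⟨args', hn'⟩ := exists_op_of_node_elimUniform hn
      obtain ⟨l, ⟨x, hx⟩, hMq, hql⟩ := hcov q σ o args' hn' hb
      refine ⟨l, ⟨x, isLeaf_elimUniform_iff.2 ⟨hx, ?_⟩⟩, hMq, hql⟩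
      by_contra hne
      have hql' : q ≠ l := by
        rintro rfl
        unfold IsLeaf at hx
        simp [hn'] at hx
      obtain ⟨nd, hnd, hP⟩ := (hM l ⟨x, hx⟩).1.1.exists_defPIANode hMq hql hql'
      exact hU l _ x hx hne q nd hql hnd hP
  largest := by
    intro q σ o args hn hb
    obtain ⟨args', hn'⟩ := exists_op_of_node_elimUniform hn
    obtain ⟨l, τ, x, hql, hx, hlar⟩ := h.largest q σ o args' hn' hb
    refine ⟨l, τ, x, hql, isLeaf_elimUniform_iff.2 ⟨hx, ?_⟩, fun l' τ' y hl' hy =>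
      hlar l' τ' y hl' (isLeaf_elimUniform_iff.1 hy).1⟩
    by_contra hne
    obtain ⟨M, hM, hcov⟩ := h.covered
    obtain ⟨l₁, ⟨x₁, hx₁⟩, hMq, hql₁⟩ := hcov q σ o args' hn' hb
    have hql' : q ≠ l₁ := by
      rintro rfl
      unfold IsLeaf at hx₁
      simp [hn'] at hx₁
    obtain ⟨nd, hnd, hP⟩ := (hM l₁ ⟨x₁, hx₁⟩).1.1.exists_defPIANode hMq hql₁ hql'
    exact hU l _ x hx hne q nd hql hnd hP

end UniformCrypto

namespace PreInverse

variable {S : LESig.{v}} (D : PreInverse S)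

/-- The two kinds of leaves of the associated inequality, for the leaf at position `l` with sign `τ`
and label `x` in the tree of sign `σ` of a term `t`. Either its sign is that of its label, positive
for nominals and negative for conominals, and there is no definite PIA node above it; or it has the
opposite sign, and its label is a free variable. -/
def LeafKind (t : Trm S.star ℕ) (σ : Bool) (l : List ℕ) (τ : Bool) (x : ℕ) : Prop :=
  ∃ v : PureVar, x = v.toProp ∧
    ((τ = v.isNom ∧ ∀ q nd, q <+: l → t.nodeAt σ q = some nd → ¬ DefPIANode nd) ∨
      (τ = (!v.isNom) ∧ ∃ k, D.free k = true ∧ D.us k = v))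

theorem leafKind_var (v : PureVar) {σ : Bool} (hσ : σ = v.isNom) {l : List ℕ} {τ : Bool} {x : ℕ}
    (hl : (Trm.var v.toProp : Trm S.star ℕ).nodeAt σ l = some (τ, .var x)) :
    D.LeafKind (Trm.var v.toProp) σ l τ x := by
  cases l with
  | cons k l => simp at hl
  | nil =>
    simp only [Trm.nodeAt_nil, Option.some.injEq, Prod.mk.injEq, Trm.var.injEq] at hl
    obtain ⟨rfl, rfl⟩ := hl
    refine ⟨v, rfl, Or.inl ⟨hσ, fun q nd hq hn => ?_⟩⟩
    obtain rfl := List.prefix_nil.1 hq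
    simp only [Trm.nodeAt_nil, Option.some.injEq] at hn
    subst hn
    exact id

theorem leafKind_ξ (k : Fin D.n) (hk : D.con k = true) (t : Trm S.star ℕ) (l₀ : List ℕ)
    {l : List ℕ} {τ : Bool} {x : ℕ}
    (hl : ((D.ξ k).rename PureVar.toProp).nodeAt (D.us k).isNom l = some (τ, .var x)) :
    D.LeafKind t (D.us k).isNom l₀ τ x := by
  have hinv := D.θ_inv k hk
  rw [Trm.rename, Trm.nodeAt_bind fun _ _ => rfl] at hl
  obtain ⟨⟨τ', a⟩, ha, h2⟩ := Option.map_eq_some_iff.1 hl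
  simp only [Prod.mk.injEq] at h2
  obtain ⟨rfl, h2⟩ := h2
  cases a with
  | var v =>
    simp only [Trm.bind, Trm.var.injEq] at h2
    refine ⟨v, h2.symm, Or.inr ⟨?_, hinv.varsIn.mem ha⟩⟩
    have hs := hinv.leafSign
    rw [Trm.leafSign_not] at hs
    simpa using hs.sign_eq ha
  | _ => simp [Trm.bind] at h2

theorem leafKind_repl (k : Fin D.n) {l : List ℕ} {τ : Bool} {x : ℕ}
    (hl : ((D.repl k).rename PureVar.toProp).nodeAt (D.us k).isNom l = some (τ, .var x)) :
    D.LeafKind ((D.repl k).rename PureVar.toProp) (D.us k).isNom l τ x := by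
  by_cases hc : D.con k = true
  · by_cases hf : D.free k = true
    · simp only [repl, hc, hf, if_true] at hl ⊢
      have key : ∀ t : Trm S.star ℕ, (∀ σ p, ¬ DefPIANode (σ, t) ∧ t.nodeAt σ (0 :: p) =
          ((D.ξ k).rename PureVar.toProp).nodeAt σ p ∧ t.nodeAt σ (1 :: p) =
          (Trm.var (D.us k).toProp : Trm S.star ℕ).nodeAt σ p ∧
          (∀ m, t.nodeAt σ ((m + 2) :: p) = none)) → (∀ y, t ≠ .var y) →
          t.nodeAt (D.us k).isNom l = some (τ, .var x) →
          D.LeafKind t (D.us k).isNom l τ x := by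
        intro t ht hv hl
        rcases l with _ | ⟨_ | _ | m, p⟩
        · simp [hv] at hl
        · rw [(ht _ p).2.1] at hl
          exact D.leafKind_ξ k hc _ _ hl
        · simp only [zero_add] at hl ⊢
          rw [(ht _ p).2.2.1] at hl
          obtain ⟨v, rfl, h | h⟩ := D.leafKind_var (D.us k) rfl hl
          · refine ⟨v, rfl, Or.inl ⟨h.1, fun q nd hq hn => ?_⟩⟩
            rcases q with _ | ⟨m, q⟩
            · simp only [Trm.nodeAt_nil, Option.some.injEq] at hn
              subst hn
              exact (ht _ []).1
            · rw [List.cons_prefix_cons] at hq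
              obtain ⟨rfl, hq⟩ := hq
              rw [(ht _ q).2.2.1] at hn
              exact h.2 q nd hq hn
          · exact ⟨v, rfl, Or.inr h⟩
        · rw [(ht _ p).2.2.2] at hl
          simp at hl
      refine key _ (fun σ p => ?_) (fun y => ?_) hl
      · rcases meetFor_cases (D.us k) (D.ξ k) (.var (D.us k)) with ⟨-, e⟩ | ⟨-, e⟩ <;> rw [e] <;>
          simp [Trm.rename, Trm.bind, DefPIANode]
      · rcases meetFor_cases (D.us k) (D.ξ k) (.var (D.us k)) with ⟨-, e⟩ | ⟨-, e⟩ <;> rw [e] <;>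
          simp [Trm.rename, Trm.bind]
    · simp only [repl, hc, hf, if_true, Bool.false_eq_true, if_false] at hl ⊢
      exact D.leafKind_ξ k hc _ _ hl
  · simp only [repl, hc, Bool.false_eq_true, if_false] at hl ⊢
    exact D.leafKind_var _ rfl hl

theorem leafKind_bind {α : Trm S.star (Fin D.n)} {σ : Bool} (hsk : α.Skel true σ)
    (hs : α.LeafSign (fun k => (D.us k).isNom) σ) {l : List ℕ} {τ : Bool} {x : ℕ}
    (hl : (α.bind fun k => (D.repl k).rename PureVar.toProp).nodeAt σ l = some (τ, .var x)) :
    D.LeafKind (α.bind fun k => (D.repl k).rename PureVar.toProp) σ l τ x := by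
  induction α generalizing σ l with
  | var k =>
    have : σ = (D.us k).isNom := hs
    subst this
    exact D.leafKind_repl k hl
  | top => cases l <;> simp [Trm.bind] at hl
  | bot => cases l <;> simp [Trm.bind] at hl
  | inf a b _ _ => exact absurd hsk.2.1 (by simp)
  | sup a b _ _ => exact absurd hsk.2.1 (by simp)
  | op h args ih =>
    cases l with
    | nil => simp [Trm.bind] at hl
    | cons k l =>
      simp only [Trm.bind, Trm.nodeAt_op_cons] at hl
      split_ifs at hl with hk
      obtain ⟨v, rfl, h1 | h1⟩ := ih ⟨k, hk⟩ (hsk.2 _) (hs _) hl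
      · refine ⟨v, rfl, Or.inl ⟨h1.1, fun q nd hq hn => ?_⟩⟩
        rcases q with _ | ⟨m, q⟩
        · simp only [Trm.nodeAt_nil, Option.some.injEq] at hn
          subst hn
          have hF := hsk.1
          change ¬ (S.star.isF h = !σ)
          rw [hF]
          simp
        · rw [List.cons_prefix_cons] at hq
          obtain ⟨rfl, hq⟩ := hq
          simp only [Trm.bind, Trm.nodeAt_op_cons, hk, dif_pos] at hn
          exact h1.2 q nd hq hn
      · exact ⟨v, rfl, Or.inr h1⟩

theorem lhs_eq : D.lhs = D.φ.bind fun k => (D.repl k).rename PureVar.toProp := by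
  simp [lhs, Trm.rename, Trm.bind_bind]

theorem rhs_eq : D.rhs = D.ψ.bind fun k => (D.repl k).rename PureVar.toProp := by
  simp [rhs, Trm.rename, Trm.bind_bind]

/-- Every free variable has a positive occurrence in the associated inequality if it is a nominal,
and a negative one if it is a conominal. -/
theorem exists_leaf_of_free {k : Fin D.n} (hk : D.free k = true) :
    ∃ l, IsLeaf D.lhs D.rhs l (D.us k).isNom (D.us k).toProp := by
  have hrepl : ∃ p, ((D.repl k).rename PureVar.toProp).nodeAt (D.us k).isNom p =
      some ((D.us k).isNom, .var (D.us k).toProp) := by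
    by_cases hc : D.con k = true
    · refine ⟨[1], ?_⟩
      simp only [repl, hc, hk, if_true]
      rcases meetFor_cases (D.us k) (D.ξ k) (.var (D.us k)) with ⟨-, e⟩ | ⟨-, e⟩ <;> rw [e] <;>
        simp [Trm.rename, Trm.bind]
    · exact ⟨[], by simp [repl, hc, Trm.rename, Trm.bind]⟩
  obtain ⟨p, hp⟩ := hrepl
  have key : ∀ (α : Trm S.star (Fin D.n)) (σ : Bool), α.count k ≠ 0 →
      α.LeafSign (fun k => (D.us k).isNom) σ → ∃ l,
      (α.bind fun k => (D.repl k).rename PureVar.toProp).nodeAt σ l =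
        some ((D.us k).isNom, .var (D.us k).toProp) := by
    intro α σ hα hs
    obtain ⟨l, τ, hl⟩ := Trm.exists_leaf_of_count_ne_zero hα σ
    obtain rfl := hs.sign_eq hl
    exact ⟨l ++ p, by rw [Trm.nodeAt_append, Trm.nodeAt_bind_of_eq_some _ hl]; exact hp⟩
  by_cases h0 : D.φ.count k = 0
  · obtain ⟨l, hl⟩ := key D.ψ false (by have := D.once k; omega) D.ψ_sign
    exact ⟨1 :: l, by rw [IsLeaf, rhs_eq]; exact hl⟩
  · obtain ⟨l, hl⟩ := key D.φ true h0 D.φ_sign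
    exact ⟨0 :: l, by rw [IsLeaf, lhs_eq]; exact hl⟩

/-- In the associated inequality of a pre-inverse correspondent no uniform variable occurs below a
definite PIA node: what occurs there is free, with a sign opposite to the one that every free
variable also has. -/
theorem not_defPIANode_above_uniform (l : List ℕ) (σ : Bool) (x : ℕ)
    (hl : IsLeaf D.lhs D.rhs l σ x) (hx : elimUniform D.lhs D.rhs x ≠ .var x) (q : List ℕ)
    (nd : Bool × Trm S.star ℕ) (hq : q <+: l) (hn : node D.lhs D.rhs q = some nd) :
    ¬ DefPIANode nd := by
  have key : ∀ (α : Trm S.star ℕ) (τ : Bool) (p p' : List ℕ), D.LeafKind α τ p σ x →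
      p' <+: p → α.nodeAt τ p' = some nd → ¬ DefPIANode nd := by
    rintro α τ p p' ⟨v, rfl, h | ⟨rfl, k, hk, rfl⟩⟩ hp hn
    · exact h.2 p' nd hp hn
    · obtain ⟨l', hl'⟩ := D.exists_leaf_of_free hk
      exact absurd (elimUniform_eq_var_of_leaves hl' hl) hx
  rcases q with _ | ⟨m, q⟩
  · simp [node] at hn
  rcases l with _ | ⟨_ | _ | m', p⟩
  · simp at hq
  · rw [List.cons_prefix_cons] at hq
    obtain ⟨rfl, hq⟩ := hq
    refine key D.lhs true p q ?_ hq hn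
    have : D.lhs.nodeAt true p = some (σ, .var x) := hl
    rw [lhs_eq] at this ⊢
    exact D.leafKind_bind D.φ_skel D.φ_sign this
  · rw [List.cons_prefix_cons] at hq
    obtain ⟨rfl, hq⟩ := hq
    refine key D.rhs false p q ?_ hq hn
    have : D.rhs.nodeAt false p = some (σ, .var x) := hl
    rw [rhs_eq] at this ⊢
    exact D.leafKind_bind D.ψ_skel D.ψ_sign this
  · simp [IsLeaf, node] at hl

end PreInverse

/-! ### Chains of residuals and their elimination: the translation and its semantics -/

section Translation

variable {S : LESig.{v}}

/-- The path from the root of the term, of sign `σ`, that follows the residuation-conservative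
coordinates consists of `-f` and `+g` nodes with new connectives and ends in a variable leaf that is
not `ε`-critical. -/
def Chain (ε : ℕ → Bool) : Bool → Trm S.star ℕ → Prop
  | σ, .var x => σ = !(ε x)
  | σ, .op (.res h i) args => (S.isF h ^^ S.tp h i) = (!σ) ∧ Chain ε (σ == S.tp h i) (args i)
  | _, _ => False

/-- The variable at the end of the path that follows the residuation-conservative coordinates. -/
def chainVar : Trm S.star ℕ → ℕ
  | .var x => x
  | .op (.res _ i) args => chainVar (args i)
  | _ => 0

/-- The tree of sign `σ` of the term has no `ε`-critical leaf. -/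
def NoCrit {S : LESig.{v}} (ε : ℕ → Bool) (σ : Bool) (t : Trm S ℕ) : Prop :=
  ∀ l x, t.nodeAt σ l ≠ some (ε x, .var x)

/-- The topmost symbol of the term is a new connective. -/
def ResRoot : Trm S.star ℕ → Prop
  | .op (.res _ _) _ => True
  | _ => False

/-- The translation into the original language: a subterm `T` with a new connective at its root
becomes the variable `e (inr T)`, a variable `x` becomes `e (inl x)`, except that a critical
occurrence of `x` becomes `K x`. -/
def translate (ε : ℕ → Bool) (e : ℕ ⊕ Trm S.star ℕ → ℕ) (K : ℕ → Trm S ℕ) :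
    Bool → Trm S.star ℕ → Trm S ℕ
  | σ, .var x => if σ = ε x then K x else .var (e (.inl x))
  | _, .top => .top
  | _, .bot => .bot
  | σ, .inf a b => .inf (translate ε e K σ a) (translate ε e K σ b)
  | σ, .sup a b => .sup (translate ε e K σ a) (translate ε e K σ b)
  | σ, .op (.base h) args => .op h fun k => translate ε e K (σ == S.tp h k) (args k)
  | _, .op (.res h i) args => .var (e (.inr (.op (.res h i) args)))

/-- The translation of terms without critical leaves. -/
abbrev translate₀ (ε : ℕ → Bool) (e : ℕ ⊕ Trm S.star ℕ → ℕ) (σ : Bool) (t : Trm S.star ℕ) :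
    Trm S ℕ := translate ε e (fun x => .var (e (.inl x))) σ t

/-- Solves an inequality for the variable at the end of a chain `T` of sign `σ`: the inequality
`T ≥ P` if `σ` is positive, `T ≤ P` if it is negative. The solution bounds the variable `x` at the
end of `T` from above if `ε x = 1`, and from below otherwise. -/
def solve (ε : ℕ → Bool) (e : ℕ ⊕ Trm S.star ℕ → ℕ) : Bool → Trm S.star ℕ → Trm S ℕ → Trm S ℕ
  | σ, .op (.res h i) args, P =>
      solve ε e (σ == S.tp h i) (args i) (.op h fun k =>
        if k = i then P else translate₀ ε e (σ == StarOp.tp (.res h i) k) (args k))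
  | _, _, P => P

/-- The term that replaces the critical occurrences of `x`: the meet, or the join if `ε x = ∂`, of
`x` and of the terms `solve T p` for the chains `T` in a given list, where `p` is the new variable
that stands for `T`. -/
def critTerm (ε : ℕ → Bool) (e : ℕ ⊕ Trm S.star ℕ → ℕ) (x : ℕ) :
    List (Bool × Trm S.star ℕ) → Trm S ℕ
  | [] => .var (e (.inl x))
  | nd :: L =>
      if ε x = true then
        .inf (solve ε e nd.1 nd.2 (.var (e (.inr nd.2)))) (critTerm ε e x L)
      else .sup (solve ε e nd.1 nd.2 (.var (e (.inr nd.2)))) (critTerm ε e x L)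

/-- A set of signed subterms that is closed under subterms and in which all new connectives lie on
chains without critical leaves. -/
structure ChainClosed (ε : ℕ → Bool) (N : Set (Bool × Trm S.star ℕ)) : Prop where
  closed : ∀ nd ∈ N, ∀ p nd', nd.2.nodeAt nd.1 p = some nd' → nd' ∈ N
  chain : ∀ nd ∈ N, ResRoot nd.2 → Chain ε nd.1 nd.2 ∧ NoCrit ε nd.1 nd.2

variable {ε : ℕ → Bool} {e : ℕ ⊕ Trm S.star ℕ → ℕ} {N : Set (Bool × Trm S.star ℕ)}

theorem ChainClosed.arg (hN : ChainClosed ε N) {σ : Bool} {h : S.star.Op}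
    {args : Fin (S.star.arity h) → Trm S.star ℕ} (ht : (σ, Trm.op h args) ∈ N)
    (k : Fin (S.star.arity h)) : (σ == S.star.tp h k, args k) ∈ N :=
  hN.closed _ ht [k.val] _ (Trm.nodeAt_op_fin σ h args k [])

theorem ChainClosed.inf (hN : ChainClosed ε N) {σ : Bool} {a b : Trm S.star ℕ}
    (ht : (σ, Trm.inf a b) ∈ N) : (σ, a) ∈ N ∧ (σ, b) ∈ N :=
  ⟨hN.closed _ ht [0] _ (by simp), hN.closed _ ht [1] _ (by simp)⟩

theorem ChainClosed.sup (hN : ChainClosed ε N) {σ : Bool} {a b : Trm S.star ℕ}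
    (ht : (σ, Trm.sup a b) ∈ N) : (σ, a) ∈ N ∧ (σ, b) ∈ N :=
  ⟨hN.closed _ ht [0] _ (by simp), hN.closed _ ht [1] _ (by simp)⟩

theorem NoCrit.arg {S : LESig.{v}} {σ : Bool} {h : S.Op} {args : Fin (S.arity h) → Trm S ℕ}
    (ht : NoCrit ε σ (Trm.op h args)) (k : Fin (S.arity h)) :
    NoCrit ε (σ == S.tp h k) (args k) :=
  fun l x hl => ht (k.val :: l) x (by rw [Trm.nodeAt_op_fin]; exact hl)

theorem sgLE_eval_critTerm {A : Type u} [CompleteLattice A]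
    (I : (h : S.Op) → (Fin (S.arity h) → A) → A) (y : ℕ → A) (x : ℕ)
    (L : List (Bool × Trm S.star ℕ)) (a : A) :
    SgLE (ε x) a ((critTerm ε e x L).eval I y) ↔ SgLE (ε x) a (y (e (.inl x))) ∧
      ∀ nd ∈ L, SgLE (ε x) a ((solve ε e nd.1 nd.2 (.var (e (.inr nd.2)))).eval I y) := by
  induction L with
  | nil => simp [critTerm, Trm.eval]
  | cons nd L ih =>
    rw [List.forall_mem_cons, and_left_comm, ← ih]
    cases hx : ε x <;> simp [critTerm, hx, Trm.eval]

/-- One step of solving an inequality along a chain: the adjunction, with the signs that occur in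
generation trees. -/
theorem sgLE_opStar_res_iff (A : PerfectLE.{u} S) (h : S.Op) (i : Fin (S.arity h)) {σ : Bool}
    (hσ : (S.isF h ^^ S.tp h i) = (!σ)) (z : Fin (S.arity h) → A.carrier) (P : A.carrier) :
    SgLE (!σ) (A.opStar (.res h i) z) P ↔
      SgLE (!(σ == S.tp h i)) (z i) (A.op h (Function.update z i P)) := by
  have h1 := A.adjunction h i z P
  have e1 : S.isF h = (σ == S.tp h i) := by
    revert hσ; cases S.isF h <;> cases S.tp h i <;> cases σ <;> decide
  have e2 : (S.isF h == S.tp h i) = σ := by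
    revert hσ; cases S.isF h <;> cases S.tp h i <;> cases σ <;> decide
  rw [e2, e1] at h1
  rw [sgLE_not, sgLE_not, h1]

theorem eval_solve_arg {A : PerfectLE.{u} S} (h : S.Op) (i : Fin (S.arity h)) (P : Trm S ℕ)
    (r : Fin (S.arity h) → Trm S ℕ) (y : ℕ → A.carrier) :
    (Trm.op h fun k => if k = i then P else r k).eval A.op y =
      A.op h (Function.update (fun k => (r k).eval A.op y) i (P.eval A.op y)) := by
  simp only [Trm.eval]
  congr 1
  funext k
  by_cases hk : k = i
  · subst hk; simp
  · simp [hk]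

/-- Let `x` be an assignment that lies, in the order of `ε`, below the values that `y` gives to the
translated variables and to the solutions for all chains. Then, in the signed order, translated
terms at `y` are below the original ones at `x`. The second part transfers inequalities along the
chains and is proved simultaneously, as the side arguments of a chain are translated too. -/
theorem sgLE_eval_translate (A : PerfectLE.{u} S) (hN : ChainClosed ε N) {x y : ℕ → A.carrier}
    (hxy : ∀ n, SgLE (ε n) (x n) (y (e (.inl n))))
    (hsolve : ∀ nd ∈ N, ResRoot nd.2 → SgLE (ε (chainVar nd.2)) (x (chainVar nd.2))
      ((solve ε e nd.1 nd.2 (.var (e (.inr nd.2)))).eval A.op y))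
    (t : Trm S.star ℕ) : ∀ σ, (σ, t) ∈ N →
      (∀ K : ℕ → Trm S ℕ, (∀ p n, t.nodeAt σ p = some (ε n, .var n) →
          SgLE (ε n) ((K n).eval A.op y) (x n)) →
        SgLE σ ((translate ε e K σ t).eval A.op y) (t.eval A.opStar x)) ∧
      (Chain ε σ t → NoCrit ε σ t → ∀ P : Trm S ℕ,
        SgLE (ε (chainVar t)) (x (chainVar t)) ((solve ε e σ t P).eval A.op y) →
        SgLE (!σ) (t.eval A.opStar x) (P.eval A.op y)) := by
  induction t with
  | var n =>
    intro σ _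
    constructor
    · intro K hK
      by_cases hσ : σ = ε n
      · subst hσ
        simpa [translate, Trm.eval] using hK [] n rfl
      · have hσ' : σ = !(ε n) := by
          revert hσ; cases σ <;> cases ε n <;> decide
        simp only [translate, hσ, if_false, Trm.eval]
        rw [hσ', sgLE_not]
        exact hxy n
    · intro hc _ P hP
      have hc : σ = !(ε n) := hc
      subst hc
      simpa [solve, chainVar, Trm.eval] using hP
  | top => exact fun σ _ => ⟨fun K _ => SgLE.refl _ _, fun h => h.elim⟩
  | bot => exact fun σ _ => ⟨fun K _ => SgLE.refl _ _, fun h => h.elim⟩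
  | inf a b iha ihb =>
    refine fun σ ht => ⟨fun K hK => ?_, fun h => h.elim⟩
    have ha := (iha σ (hN.inf ht).1).1 K fun p n h => hK (0 :: p) n (by simpa using h)
    have hb := (ihb σ (hN.inf ht).2).1 K fun p n h => hK (1 :: p) n (by simpa using h)
    cases σ <;> exact inf_le_inf ha hb
  | sup a b iha ihb =>
    refine fun σ ht => ⟨fun K hK => ?_, fun h => h.elim⟩
    have ha := (iha σ (hN.sup ht).1).1 K fun p n h => hK (0 :: p) n (by simpa using h)
    have hb := (ihb σ (hN.sup ht).2).1 K fun p n h => hK (1 :: p) n (by simpa using h)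
    cases σ <;> exact sup_le_sup ha hb
  | op o args ih =>
    cases o with
    | base h =>
      refine fun σ ht => ⟨fun K hK => ?_, fun h => h.elim⟩
      refine A.residuated_op.sgMono h σ fun k => ?_
      exact (ih k _ (hN.arg ht k)).1 K fun p n hp =>
        hK (k.val :: p) n (by rw [Trm.nodeAt_op_fin]; exact hp)
    | res h i =>
      intro σ ht
      have key : Chain ε σ (Trm.op (.res h i) args : Trm S.star ℕ) →
          NoCrit ε σ (Trm.op (.res h i) args : Trm S.star ℕ) → ∀ P : Trm S ℕ,
          SgLE (ε (chainVar (args i))) (x (chainVar (args i)))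
            ((solve ε e σ (Trm.op (.res h i) args) P).eval A.op y) →
          SgLE (!σ) ((Trm.op (.res h i) args : Trm S.star ℕ).eval A.opStar x)
            (P.eval A.op y) := by
        intro hc hnc P hP
        have harg : StarOp.tp (.res h i) i = S.tp h i := if_pos rfl
        have hi := hN.arg ht i
        have hni := hnc.arg i
        change (σ == StarOp.tp (.res h i) i, args i) ∈ N at hi
        change NoCrit ε (σ == StarOp.tp (.res h i) i) (args i) at hni
        rw [harg] at hi hni
        have h1 := (ih i _ hi).2 hc.2 hni _ hP
        change SgLE (!σ) (A.opStar (.res h i) fun k => (args k).eval A.opStar x) _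
        rw [sgLE_opStar_res_iff A h i hc.1]
        refine h1.trans ?_
        rw [eval_solve_arg h i P
          (fun k => translate₀ ε e (σ == StarOp.tp (.res h i) k) (args k)) y]
        refine A.residuated_op.sgMono h _ fun k => ?_
        by_cases hk : k = i
        · subst hk
          simpa using SgLE.refl _ _
        · have h2 := (ih k _ (hN.arg ht k)).1 (fun n => .var (e (.inl n)))
            fun p n hp => absurd hp (hnc.arg k p n)
          have e1 : (σ == StarOp.tp (.res h i) k) = ((!(σ == S.tp h i)) == S.tp h k) := by
            simp only [StarOp.tp, if_neg hk]
            cases σ <;> cases S.tp h i <;> cases S.tp h k <;> rfl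
          simp only [Function.update_of_ne hk]
          rw [← e1]
          exact h2
      refine ⟨fun K _ => ?_, key⟩
      obtain ⟨hc, hnc⟩ := hN.chain _ ht trivial
      have h1 := key hc hnc _ (hsolve _ ht trivial)
      rwa [sgLE_not] at h1

/-- If the new variables take the values of the chains for which they stand, then the translation
preserves values, and the variable at the end of a chain is below its solution. -/
theorem eval_translate_eq (A : PerfectLE.{u} S) (hN : ChainClosed ε N) {x y : ℕ → A.carrier}
    (hxy : ∀ n, y (e (.inl n)) = x n)
    (hres : ∀ nd ∈ N, ResRoot nd.2 → y (e (.inr nd.2)) = nd.2.eval A.opStar x)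
    (t : Trm S.star ℕ) : ∀ σ, (σ, t) ∈ N →
      (∀ K : ℕ → Trm S ℕ, (∀ n, (K n).eval A.op y = x n) →
        (translate ε e K σ t).eval A.op y = t.eval A.opStar x) ∧
      (Chain ε σ t → ∀ P : Trm S ℕ, SgLE (!σ) (t.eval A.opStar x) (P.eval A.op y) →
        SgLE (ε (chainVar t)) (x (chainVar t)) ((solve ε e σ t P).eval A.op y)) := by
  induction t with
  | var n =>
    intro σ _
    constructor
    · intro K hK
      by_cases hσ : σ = ε n
      · simp [translate, hσ, hK, Trm.eval]
      · simp [translate, hσ, Trm.eval, hxy]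
    · intro hc P hP
      have hc : σ = !(ε n) := hc
      subst hc
      simpa [solve, chainVar, Trm.eval] using hP
  | top => exact fun σ _ => ⟨fun K _ => rfl, fun h => h.elim⟩
  | bot => exact fun σ _ => ⟨fun K _ => rfl, fun h => h.elim⟩
  | inf a b iha ihb =>
    refine fun σ ht => ⟨fun K hK => ?_, fun h => h.elim⟩
    simp only [translate, Trm.eval, (iha σ (hN.inf ht).1).1 K hK, (ihb σ (hN.inf ht).2).1 K hK]
  | sup a b iha ihb =>
    refine fun σ ht => ⟨fun K hK => ?_, fun h => h.elim⟩
    simp only [translate, Trm.eval, (iha σ (hN.sup ht).1).1 K hK, (ihb σ (hN.sup ht).2).1 K hK]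
  | op o args ih =>
    cases o with
    | base h =>
      refine fun σ ht => ⟨fun K hK => ?_, fun h => h.elim⟩
      change A.op h _ = A.op h _
      congr 1
      funext k
      exact (ih k _ (hN.arg ht k)).1 K hK
    | res h i =>
      refine fun σ ht => ⟨fun K _ => hres _ ht trivial, fun hc P hP => ?_⟩
      have harg : StarOp.tp (.res h i) i = S.tp h i := if_pos rfl
      have hi := hN.arg ht i
      change (σ == StarOp.tp (.res h i) i, args i) ∈ N at hi
      rw [harg] at hi
      refine (ih i _ hi).2 hc.2 _ ?_
      rw [eval_solve_arg h i P
        (fun k => translate₀ ε e (σ == StarOp.tp (.res h i) k) (args k)) y]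
      have e1 : (fun k => (translate₀ ε e (σ == StarOp.tp (.res h i) k) (args k)).eval A.op y) =
          fun k => (args k).eval A.opStar x := by
        funext k
        exact (ih k _ (hN.arg ht k)).1 _ hxy
      rw [e1]
      exact (sgLE_opStar_res_iff A h i hc.1 _ _).1 hP

/-- The translation of an inequality is equivalent to it, if a decoding `d` of the variables is
given and the critical occurrences of `n` are replaced by `critTerm ε e n (L n)` where `L n` lists
the chains that end in `n`. -/
theorem validStar_iff_valid_translate (A : PerfectLE.{u} S) (hN : ChainClosed ε N)
    {d : ℕ → ℕ ⊕ Trm S.star ℕ} (hd : ∀ n, d (e (.inl n)) = .inl n)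
    (hd' : ∀ nd ∈ N, d (e (.inr nd.2)) = .inr nd.2) (L : ℕ → List (Bool × Trm S.star ℕ))
    (hL : ∀ n nd, nd ∈ L n ↔ nd ∈ N ∧ ResRoot nd.2 ∧ chainVar nd.2 = n)
    {s t : Trm S.star ℕ} (hs : (true, s) ∈ N) (ht : (false, t) ∈ N) :
    A.ValidStar s t ↔ A.Valid (translate ε e (fun n => critTerm ε e n (L n)) true s)
      (translate ε e (fun n => critTerm ε e n (L n)) false t) := by
  constructor
  · intro h y
    let x : ℕ → A.carrier := fun n => (critTerm ε e n (L n)).eval A.op y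
    have hx := fun n => (sgLE_eval_critTerm (ε := ε) (e := e) A.op y n (L n) (x n)).1
      (SgLE.refl _ _)
    have key := sgLE_eval_translate A hN (x := x) (y := y) (fun n => (hx n).1)
      fun nd hnd hr => (hx _).2 nd ((hL _ _).2 ⟨hnd, hr, rfl⟩)
    have h1 := (key s true hs).1 (fun n => critTerm ε e n (L n)) fun _ _ _ => SgLE.refl _ _
    have h2 := (key t false ht).1 (fun n => critTerm ε e n (L n)) fun _ _ _ => SgLE.refl _ _
    exact (le_trans h1 (h x)).trans h2
  · intro h x
    let y : ℕ → A.carrier := fun c => Sum.elim x (fun T => T.eval A.opStar x) (d c)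
    have hxy : ∀ n, y (e (.inl n)) = x n := fun n => by simp [y, hd]
    have key := eval_translate_eq A hN hxy fun nd hnd _ => by simp [y, hd' nd hnd]
    have hK : ∀ n, (critTerm ε e n (L n)).eval A.op y = x n := by
      intro n
      have h1 : SgLE (ε n) (x n) ((critTerm ε e n (L n)).eval A.op y) := by
        rw [sgLE_eval_critTerm]
        refine ⟨by rw [hxy]; exact SgLE.refl _ _, fun nd hnd => ?_⟩
        obtain ⟨hnN, hr, rfl⟩ := (hL _ _).1 hnd
        refine (key nd.2 nd.1 hnN).2 (hN.chain nd hnN hr).1 _ ?_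
        simp only [Trm.eval, y, hd' nd hnN]
        exact SgLE.refl _ _
      have h2 := ((sgLE_eval_critTerm (ε := ε) (e := e) A.op y n (L n) _).1 (SgLE.refl _ _)).1
      rw [hxy] at h2
      revert h1 h2
      cases ε n
      · exact fun h1 h2 => le_antisymm h1 h2
      · exact fun h1 h2 => le_antisymm h2 h1
    have := h y
    rwa [(key s true hs).1 _ hK, (key t false ht).1 _ hK] at this

end Translation

/-! ### Shape of branches -/

section Shape

variable {S : LESig.{v}} {ε : ℕ → Bool} {Ω : ℕ → ℕ → Prop}

/-- The analogue of `BranchShape` for a single signed generation tree. -/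
def TreeShape (σ : Bool) (t : Trm S ℕ) (l : List ℕ) (a b : ℕ) : Prop :=
  a ≤ b ∧ ∀ q nd, q <+: l → q ≠ l → t.nodeAt σ q = some nd →
    (q.length < a ∧ DefSkelNode nd) ∨
    (a ≤ q.length ∧ q.length < b ∧ MeetNode nd) ∨
    (b ≤ q.length ∧ DefPIANode nd)

/-- The leaf at position `l`, labelled `x`, satisfies the conditions that are required of the
critical leaves of inductive inequalities, with the branch divided at the depths `a` and `b`. -/
def GoodLeaf (ε : ℕ → Bool) (Ω : ℕ → ℕ → Prop) (σ : Bool) (t : Trm S ℕ) (l : List ℕ) (x : ℕ)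
    (a b : ℕ) : Prop :=
  TreeShape σ t l a b ∧ ∀ q nd, q <+: l → q ≠ l → t.nodeAt σ q = some nd → SRRNode nd →
    (∀ l' x', q <+: l' → t.nodeAt σ l' = some (ε x', .var x') → l' = l) ∧
    (∀ l' τ y, q <+: l' → t.nodeAt σ l' = some (τ, .var y) → y ≠ x → Ω y x)

theorem goodLeaf_nil (σ : Bool) (t : Trm S ℕ) (x : ℕ) : GoodLeaf ε Ω σ t [] x 0 0 :=
  ⟨⟨le_rfl, fun _ _ hq hne => absurd (List.prefix_nil.1 hq) hne⟩,
    fun _ _ hq hne => absurd (List.prefix_nil.1 hq) hne⟩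

/-- A node may be put on top of a branch if it continues the branch in the prescribed order. -/
theorem GoodLeaf.cons {σ τ : Bool} {t c : Trm S ℕ} {k : ℕ}
    (hc : ∀ p, t.nodeAt σ (k :: p) = c.nodeAt τ p) {l : List ℕ} {x a b a' b' : ℕ}
    (h : GoodLeaf ε Ω τ c l x a b)
    (hroot : (a' = a + 1 ∧ b' = b + 1 ∧ DefSkelNode (σ, t)) ∨
      (a = 0 ∧ a' = 0 ∧ b' = b + 1 ∧ MeetNode (σ, t)) ∨
      (a = 0 ∧ b = 0 ∧ a' = 0 ∧ b' = 0 ∧ DefPIANode (σ, t)))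
    (hsrr : SRRNode (σ, t) →
      (∀ l' x', t.nodeAt σ l' = some (ε x', .var x') → l' = k :: l) ∧
      (∀ l' τ' y, t.nodeAt σ l' = some (τ', .var y) → y ≠ x → Ω y x)) :
    GoodLeaf ε Ω σ t (k :: l) x a' b' := by
  obtain ⟨⟨hab, hs⟩, hu⟩ := h
  refine ⟨⟨by omega, fun q nd hq hne hn => ?_⟩, fun q nd hq hne hn hnd => ?_⟩
  · rcases q with _ | ⟨m, q⟩
    · simp only [Trm.nodeAt_nil, Option.some.injEq] at hn
      subst hn
      simp only [List.length_nil]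
      rcases hroot with ⟨h1, h2, h3⟩ | ⟨-, h1, h2, h3⟩ | ⟨-, -, h1, h2, h3⟩
      · exact Or.inl ⟨by omega, h3⟩
      · exact Or.inr (Or.inl ⟨by omega, by omega, h3⟩)
      · exact Or.inr (Or.inr ⟨by omega, h3⟩)
    · rw [List.cons_prefix_cons] at hq
      obtain ⟨rfl, hq⟩ := hq
      rw [hc] at hn
      have := hs q nd hq (fun e => hne (by rw [e])) hn
      simp only [List.length_cons]
      rcases this with ⟨h1, h3⟩ | ⟨h1, h2, h3⟩ | ⟨h1, h3⟩
      · exact Or.inl ⟨by omega, h3⟩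
      · refine Or.inr (Or.inl ⟨by omega, by omega, h3⟩)
      · exact Or.inr (Or.inr ⟨by omega, h3⟩)
  · rcases q with _ | ⟨m, q⟩
    · simp only [Trm.nodeAt_nil, Option.some.injEq] at hn
      subst hn
      exact ⟨fun l' x' _ => (hsrr hnd).1 l' x', fun l' τ' y _ => (hsrr hnd).2 l' τ' y⟩
    · rw [List.cons_prefix_cons] at hq
      obtain ⟨rfl, hq⟩ := hq
      rw [hc] at hn
      have := hu q nd hq (fun e => hne (by rw [e])) hn hnd
      constructor
      · intro l' x' hl' hx'
        rcases l' with _ | ⟨m', l'⟩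
        · simp at hl'
        rw [List.cons_prefix_cons] at hl'
        obtain ⟨rfl, hl'⟩ := hl'
        rw [hc] at hx'
        rw [this.1 l' x' hl' hx']
      · intro l' τ' y hl' hy
        rcases l' with _ | ⟨m', l'⟩
        · simp at hl'
        rw [List.cons_prefix_cons] at hl'
        obtain ⟨rfl, hl'⟩ := hl'
        rw [hc] at hy
        exact this.2 l' τ' y hl' hy

theorem TreeShape.tail {σ τ : Bool} {t c : Trm S ℕ} {k : ℕ}
    (hc : ∀ p, t.nodeAt σ (k :: p) = c.nodeAt τ p) {l : List ℕ} {a b : ℕ}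
    (h : TreeShape σ t (k :: l) a b) : TreeShape τ c l (a - 1) (b - 1) := by
  refine ⟨Nat.sub_le_sub_right h.1 1, fun q nd hq hne hn => ?_⟩
  have := h.2 (k :: q) nd (List.cons_prefix_cons.2 ⟨rfl, hq⟩) (by simpa using hne)
    (by rw [hc]; exact hn)
  simp only [List.length_cons] at this
  rcases this with ⟨h1, h3⟩ | ⟨h1, h2, h3⟩ | ⟨h1, h3⟩
  · exact Or.inl ⟨by omega, h3⟩
  · exact Or.inr (Or.inl ⟨by omega, by omega, h3⟩)
  · exact Or.inr (Or.inr ⟨by omega, h3⟩)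

theorem meetNode_not_srr {nd : Bool × Trm S ℕ} (h : MeetNode nd) : ¬ SRRNode nd := by
  obtain ⟨σ, t⟩ := nd
  cases t <;> simp_all [MeetNode, SRRNode]

theorem defSkelNode_not_srr {nd : Bool × Trm S ℕ} (h : DefSkelNode nd) : ¬ SRRNode nd := by
  obtain ⟨σ, t⟩ := nd
  cases t <;> simp_all [DefSkelNode, SRRNode]

/-- The tree of sign `σ` of the term has a single critical leaf, labelled `c`; only definite PIA
nodes lie above it, and all other variables are `Ω`-smaller. -/
def PIAFor (ε : ℕ → Bool) (Ω : ℕ → ℕ → Prop) (c : ℕ) (σ : Bool) (t : Trm S ℕ) : Prop :=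
  (∃ l₀, GoodLeaf ε Ω σ t l₀ c 0 0 ∧ ∀ l x, t.nodeAt σ l = some (ε x, .var x) → l = l₀ ∧ x = c) ∧
  ∀ l τ y, t.nodeAt σ l = some (τ, .var y) → y ≠ c → Ω y c

theorem piaFor_var (c : ℕ) : PIAFor ε Ω c (ε c) (.var c : Trm S ℕ) := by
  refine ⟨⟨[], goodLeaf_nil _ _ _, fun l x hl => ?_⟩, fun l τ y hl hne => ?_⟩
  · cases l with
    | nil =>
      simp only [Trm.nodeAt_nil, Option.some.injEq, Prod.mk.injEq, Trm.var.injEq] at hl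
      exact ⟨rfl, hl.2.symm⟩
    | cons k l => simp at hl
  · cases l with
    | nil =>
      simp only [Trm.nodeAt_nil, Option.some.injEq, Prod.mk.injEq, Trm.var.injEq] at hl
      exact absurd hl.2.symm hne
    | cons k l => simp at hl

theorem PIAFor.op {c : ℕ} {σ : Bool} {h : S.Op} {args : Fin (S.arity h) → Trm S ℕ}
    {i : Fin (S.arity h)} (hF : S.isF h = !σ) (hi : PIAFor ε Ω c (σ == S.tp h i) (args i))
    (hcrit : ∀ k, k ≠ i → NoCrit ε (σ == S.tp h k) (args k))
    (hvars : ∀ k, k ≠ i → ∀ l τ y, (args k).nodeAt (σ == S.tp h k) l = some (τ, .var y) → Ω y c) :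
    PIAFor ε Ω c σ (.op h args) := by
  obtain ⟨⟨l₀, hg, huniq⟩, hv⟩ := hi
  have huniq' : ∀ l x, (Trm.op h args).nodeAt σ l = some (ε x, .var x) → l = i.val :: l₀ ∧ x = c := by
    intro l x hl
    rcases l with _ | ⟨m, l⟩
    · simp at hl
    simp only [Trm.nodeAt_op_cons] at hl
    split_ifs at hl with hm
    by_cases hmi : (⟨m, hm⟩ : Fin (S.arity h)) = i
    · subst hmi
      obtain ⟨rfl, rfl⟩ := huniq l x hl
      exact ⟨rfl, rfl⟩
    · exact absurd hl (hcrit _ hmi l x)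
  have hv' : ∀ l τ y, (Trm.op h args).nodeAt σ l = some (τ, .var y) → y ≠ c → Ω y c := by
    intro l τ y hl hne
    rcases l with _ | ⟨m, l⟩
    · simp at hl
    simp only [Trm.nodeAt_op_cons] at hl
    split_ifs at hl with hm
    by_cases hmi : (⟨m, hm⟩ : Fin (S.arity h)) = i
    · subst hmi
      exact hv l τ y hl hne
    · exact hvars _ hmi l τ y hl
  exact ⟨⟨i.val :: l₀, hg.cons (Trm.nodeAt_op_fin σ h args i)
    (Or.inr (Or.inr ⟨rfl, rfl, rfl, rfl, hF⟩))
    fun _ => ⟨fun l' x' hl' => (huniq' l' x' hl').1, hv'⟩, huniq'⟩, hv'⟩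

end Shape

/-! ### Shape of the translation -/

section TranslationShape

variable {S : LESig.{v}} {ε : ℕ → Bool} {e : ℕ ⊕ Trm S.star ℕ → ℕ} {d : ℕ → ℕ ⊕ Trm S.star ℕ}
  {N : Set (Bool × Trm S.star ℕ)}

/-- The number of inner nodes of a term. -/
def Trm.size {S : LESig.{v}} {V : Type} : Trm S V → ℕ
  | var _ => 0
  | top => 0
  | bot => 0
  | inf a b => a.size + b.size + 1
  | sup a b => a.size + b.size + 1
  | op _ args => ∑ i, (args i).size + 1

theorem Trm.size_arg_lt {S : LESig.{v}} {V : Type} (h : S.Op) (args : Fin (S.arity h) → Trm S V)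
    (k : Fin (S.arity h)) : (args k).size < (Trm.op h args).size :=
  Nat.lt_succ_of_le (Finset.single_le_sum (f := fun k => (args k).size)
    (fun _ _ => Nat.zero_le _) (Finset.mem_univ k))

theorem Trm.size_le_of_nodeAt {S : LESig.{v}} {V : Type} {t : Trm S V} {σ : Bool} {p : List ℕ}
    {nd : Bool × Trm S V} (h : t.nodeAt σ p = some nd) : nd.2.size ≤ t.size := by
  induction p generalizing σ t with
  | nil =>
    simp only [nodeAt_nil, Option.some.injEq] at h
    subst h
    exact le_rfl
  | cons k p ih =>
    cases t with
    | var y => simp at h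
    | top => simp at h
    | bot => simp at h
    | inf a b =>
      simp only [nodeAt_inf_cons] at h
      split_ifs at h <;> have := ih h <;> simp only [size] <;> omega
    | sup a b =>
      simp only [nodeAt_sup_cons] at h
      split_ifs at h <;> have := ih h <;> simp only [size] <;> omega
    | op o args =>
      simp only [nodeAt_op_cons] at h
      split_ifs at h
      exact (ih h).trans (size_arg_lt o args _).le

/-- The order type of the variables of the translation. The sign of a new variable is such that it
is not critical where it stands for a chain. -/
def codeSign (ε : ℕ → Bool) (d : ℕ → ℕ ⊕ Trm S.star ℕ) (c : ℕ) : Bool :=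
  match d c with
  | .inl n => ε n
  | .inr (.op h _) => S.star.isF h
  | .inr _ => true

/-- The dependency order of the variables of the translation: the old variables are smaller than
the new ones, and the latter are ordered by the size of the chains for which they stand. -/
def CodeLT (d : ℕ → ℕ ⊕ Trm S.star ℕ) (a b : ℕ) : Prop :=
  match d a, d b with
  | .inl _, .inr _ => True
  | .inr T, .inr T' => T.size < T'.size
  | _, .inl _ => False

theorem isStrict_codeLT (d : ℕ → ℕ ⊕ Trm S.star ℕ) : IsStrict (CodeLT d) := by
  constructor
  · intro x
    unfold CodeLT
    cases d x <;> simp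
  · intro x y z
    unfold CodeLT
    cases d x <;> cases d y <;> cases d z <;> simp
    exact lt_trans


theorem ChainClosed.isF_eq (hN : ChainClosed ε N) {σ : Bool} {h : S.Op} {i : Fin (S.arity h)}
    {args : Fin (S.star.arity (.res h i)) → Trm S.star ℕ}
    (ht : (σ, (Trm.op (.res h i) args : Trm S.star ℕ)) ∈ N) : (S.isF h ^^ S.tp h i) = !σ :=
  (hN.chain _ ht trivial).1.1

/-- A critical leaf of the translation belongs to the term that has replaced a critical leaf. -/
theorem exists_of_crit_translate (hN : ChainClosed ε N) (hd : ∀ n, d (e (.inl n)) = .inl n)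
    (hd' : ∀ nd ∈ N, d (e (.inr nd.2)) = .inr nd.2) (K : ℕ → Trm S ℕ) {t : Trm S.star ℕ}
    {σ : Bool} (ht : (σ, t) ∈ N) {l : List ℕ} {x : ℕ}
    (hl : (translate ε e K σ t).nodeAt σ l = some (codeSign ε d x, .var x)) :
    ∃ l₁ l₂ n, l = l₁ ++ l₂ ∧ t.nodeAt σ l₁ = some (ε n, .var n) ∧
      (K n).nodeAt (ε n) l₂ = some (codeSign ε d x, .var x) := by
  induction t generalizing σ l with
  | var n =>
    by_cases hσ : σ = ε n
    · subst hσ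
      refine ⟨[], l, n, rfl, rfl, ?_⟩
      simpa [translate] using hl
    · simp only [translate, hσ, if_false] at hl
      cases l with
      | nil =>
        simp only [Trm.nodeAt_nil, Option.some.injEq, Prod.mk.injEq, Trm.var.injEq] at hl
        obtain ⟨h1, rfl⟩ := hl
        simp only [codeSign, hd] at h1
        exact absurd h1 hσ
      | cons k l => simp at hl
  | top => cases l <;> simp [translate] at hl
  | bot => cases l <;> simp [translate] at hl
  | inf a b iha ihb =>
    rcases l with _ | ⟨k, l⟩
    · simp [translate] at hl
    simp only [translate, Trm.nodeAt_inf_cons] at hl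
    split_ifs at hl with h0 h1
    · obtain ⟨l₁, l₂, n, rfl, h2, h3⟩ := iha (hN.inf ht).1 hl
      exact ⟨k :: l₁, l₂, n, rfl, by simpa [h0] using h2, h3⟩
    · obtain ⟨l₁, l₂, n, rfl, h2, h3⟩ := ihb (hN.inf ht).2 hl
      exact ⟨k :: l₁, l₂, n, rfl, by simpa [h1] using h2, h3⟩
  | sup a b iha ihb =>
    rcases l with _ | ⟨k, l⟩
    · simp [translate] at hl
    simp only [translate, Trm.nodeAt_sup_cons] at hl
    split_ifs at hl with h0 h1
    · obtain ⟨l₁, l₂, n, rfl, h2, h3⟩ := iha (hN.sup ht).1 hl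
      exact ⟨k :: l₁, l₂, n, rfl, by simpa [h0] using h2, h3⟩
    · obtain ⟨l₁, l₂, n, rfl, h2, h3⟩ := ihb (hN.sup ht).2 hl
      exact ⟨k :: l₁, l₂, n, rfl, by simpa [h1] using h2, h3⟩
  | op o args ih =>
    cases o with
    | base h =>
      rcases l with _ | ⟨k, l⟩
      · simp [translate] at hl
      simp only [translate, Trm.nodeAt_op_cons] at hl
      split_ifs at hl with hk
      obtain ⟨l₁, l₂, n, rfl, h2, h3⟩ := ih ⟨k, hk⟩ (hN.arg ht ⟨k, hk⟩) hl
      refine ⟨k :: l₁, l₂, n, rfl, ?_, h3⟩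
      rw [Trm.nodeAt_op_cons, dif_pos (show k < S.star.arity (.base h) from hk)]
      exact h2
    | res h i =>
      exfalso
      cases l with
      | nil =>
        simp only [translate, Trm.nodeAt_nil, Option.some.injEq, Prod.mk.injEq,
          Trm.var.injEq] at hl
        obtain ⟨h1, rfl⟩ := hl
        rw [codeSign, hd' _ ht] at h1
        have h2 := hN.isF_eq ht
        have h3 : σ = (S.isF h ^^ S.tp h i) := h1
        rw [← h3] at h2
        exact absurd h2 (by cases σ <;> decide)
      | cons k l => simp [translate] at hl

theorem noCrit_translate₀ (hN : ChainClosed ε N) (hd : ∀ n, d (e (.inl n)) = .inl n)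
    (hd' : ∀ nd ∈ N, d (e (.inr nd.2)) = .inr nd.2) {t : Trm S.star ℕ} {σ : Bool}
    (ht : (σ, t) ∈ N) (hnc : NoCrit ε σ t) : NoCrit (codeSign ε d) σ (translate₀ ε e σ t) := by
  intro l x hl
  obtain ⟨l₁, l₂, n, -, h1, -⟩ := exists_of_crit_translate hN hd hd' _ ht hl
  exact hnc l₁ n h1

/-- The variables of the translation of a term without critical leaves are old ones or stand for
subterms. -/
theorem var_translate₀ {t : Trm S.star ℕ} {σ τ : Bool} {l : List ℕ} {y : ℕ}
    (hl : (translate₀ ε e σ t).nodeAt σ l = some (τ, .var y)) :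
    (∃ n, y = e (.inl n)) ∨ ∃ T, y = e (.inr T) ∧ ∃ p τ', t.nodeAt σ p = some (τ', T) := by
  induction t generalizing σ l with
  | var n =>
    left
    cases l with
    | nil =>
      simp only [translate₀, translate, ite_self, Trm.nodeAt_nil, Option.some.injEq,
        Prod.mk.injEq, Trm.var.injEq] at hl
      exact ⟨n, hl.2.symm⟩
    | cons k l => simp [translate] at hl
  | top => cases l <;> simp [translate] at hl
  | bot => cases l <;> simp [translate] at hl
  | inf a b iha ihb =>
    rcases l with _ | ⟨k, l⟩
    · simp [translate] at hl
    simp only [translate₀, translate, Trm.nodeAt_inf_cons] at hl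
    split_ifs at hl with h0 h1
    · exact (iha hl).imp id fun ⟨T, hT, p, τ', hp⟩ => ⟨T, hT, 0 :: p, τ', by simpa using hp⟩
    · exact (ihb hl).imp id fun ⟨T, hT, p, τ', hp⟩ => ⟨T, hT, 1 :: p, τ', by simpa using hp⟩
  | sup a b iha ihb =>
    rcases l with _ | ⟨k, l⟩
    · simp [translate] at hl
    simp only [translate₀, translate, Trm.nodeAt_sup_cons] at hl
    split_ifs at hl with h0 h1
    · exact (iha hl).imp id fun ⟨T, hT, p, τ', hp⟩ => ⟨T, hT, 0 :: p, τ', by simpa using hp⟩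
    · exact (ihb hl).imp id fun ⟨T, hT, p, τ', hp⟩ => ⟨T, hT, 1 :: p, τ', by simpa using hp⟩
  | op o args ih =>
    cases o with
    | base h =>
      rcases l with _ | ⟨k, l⟩
      · simp [translate] at hl
      simp only [translate₀, translate, Trm.nodeAt_op_cons] at hl
      split_ifs at hl with hk
      refine (ih ⟨k, hk⟩ hl).imp id fun ⟨T, hT, p, τ', hp⟩ => ⟨T, hT, k :: p, τ', ?_⟩
      rw [Trm.nodeAt_op_cons, dif_pos (show k < S.star.arity (.base h) from hk)]
      exact hp
    | res h i =>
      right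
      cases l with
      | nil =>
        simp only [translate₀, translate, Trm.nodeAt_nil, Option.some.injEq, Prod.mk.injEq,
          Trm.var.injEq] at hl
        exact ⟨_, hl.2.symm, [], σ, rfl⟩
      | cons k l => simp [translate] at hl

/-- Solving an inequality along a chain no larger than `T₀` turns a PIA term for the variable that
stands for `T₀` into another one. -/
theorem piaFor_solve (hN : ChainClosed ε N) (hd : ∀ n, d (e (.inl n)) = .inl n)
    (hd' : ∀ nd ∈ N, d (e (.inr nd.2)) = .inr nd.2) {nd₀ : Bool × Trm S.star ℕ} (h₀ : nd₀ ∈ N)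
    (t : Trm S.star ℕ) : ∀ σ, (σ, t) ∈ N → Chain ε σ t → NoCrit ε σ t → t.size ≤ nd₀.2.size →
      ∀ P, PIAFor (codeSign ε d) (CodeLT d) (e (.inr nd₀.2)) (!σ) P →
        PIAFor (codeSign ε d) (CodeLT d) (e (.inr nd₀.2)) (ε (chainVar t)) (solve ε e σ t P) := by
  induction t with
  | var n =>
    intro σ _ hc _ _ P hP
    have hc : σ = !(ε n) := hc
    subst hc
    simpa [solve, chainVar] using hP
  | top => exact fun _ _ h => h.elim
  | bot => exact fun _ _ h => h.elim
  | inf a b _ _ => exact fun _ _ h => h.elim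
  | sup a b _ _ => exact fun _ _ h => h.elim
  | op o args ih =>
    cases o with
    | base h => exact fun _ _ h => h.elim
    | res h i =>
      intro σ ht hc hnc hsize P hP
      have harg : StarOp.tp (.res h i) i = S.tp h i := if_pos rfl
      have hi := hN.arg ht i
      have hni := hnc.arg i
      change (σ == StarOp.tp (.res h i) i, args i) ∈ N at hi
      change NoCrit ε (σ == StarOp.tp (.res h i) i) (args i) at hni
      rw [harg] at hi hni
      have hlt : ∀ k, (args k).size < nd₀.2.size := fun k =>
        (Trm.size_arg_lt (S := S.star) (.res h i) args k).trans_le hsize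
      have hcF := hc.1
      have e1 : ∀ k, k ≠ i →
          (σ == StarOp.tp (.res h i) k) = ((!(σ == S.tp h i)) == S.tp h k) := by
        intro k hk
        simp only [StarOp.tp, if_neg hk]
        cases σ <;> cases S.tp h i <;> cases S.tp h k <;> rfl
      refine ih i _ hi hc.2 hni (hlt i).le _ (PIAFor.op (i := i) ?_ ?_ ?_ ?_)
      · revert hcF; cases S.isF h <;> cases S.tp h i <;> cases σ <;> decide
      · have e2 : ((!(σ == S.tp h i)) == S.tp h i) = !σ := by
          cases σ <;> cases S.tp h i <;> rfl
        rw [e2, if_pos rfl]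
        exact hP
      · intro k hk
        rw [if_neg hk, ← e1 k hk]
        exact noCrit_translate₀ hN hd hd' (hN.arg ht k) (hnc.arg k)
      · intro k hk l τ y hl
        rw [if_neg hk, ← e1 k hk] at hl
        unfold CodeLT
        rw [hd' _ h₀]
        rcases var_translate₀ hl with ⟨n, rfl⟩ | ⟨T, rfl, p, τ', hp⟩
        · rw [hd]
          trivial
        · rw [hd' (τ', T) (hN.closed _ (hN.arg ht k) p _ hp)]
          exact (Trm.size_le_of_nodeAt hp).trans_lt (hlt k)

theorem goodLeaf_critTerm (hN : ChainClosed ε N) (hd : ∀ n, d (e (.inl n)) = .inl n)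
    (hd' : ∀ nd ∈ N, d (e (.inr nd.2)) = .inr nd.2) (n : ℕ) (L : List (Bool × Trm S.star ℕ))
    (hL : ∀ nd ∈ L, nd ∈ N ∧ ResRoot nd.2 ∧ chainVar nd.2 = n) {l : List ℕ} {x : ℕ}
    (hl : (critTerm ε e n L).nodeAt (ε n) l = some (codeSign ε d x, .var x)) :
    ∃ b, GoodLeaf (codeSign ε d) (CodeLT d) (ε n) (critTerm ε e n L) l x 0 b := by
  induction L generalizing l with
  | nil =>
    cases l with
    | nil => exact ⟨0, goodLeaf_nil _ _ _⟩
    | cons k l => simp [critTerm] at hl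
  | cons nd L ih =>
    have ih := fun l => ih (l := l) fun nd' h' => hL nd' (List.mem_cons_of_mem _ h')
    obtain ⟨hnd, hr, hv⟩ := hL nd (by simp)
    obtain ⟨hc, hnc⟩ := hN.chain nd hnd hr
    have hpia := piaFor_solve hN hd hd' hnd nd.2 nd.1 hnd hc hnc le_rfl
      (.var (e (.inr nd.2))) (by
        have : (!nd.1) = codeSign ε d (e (.inr nd.2)) := by
          rw [codeSign, hd' _ hnd]
          obtain ⟨σ, T⟩ := nd
          match T, hr, hc with
          | .op (.res h i) args, _, hc => exact hc.1.symm
        rw [this]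
        exact piaFor_var _)
    rw [hv] at hpia
    -- both lattice connectives are meets in the signed order
    have key : ∀ t : Trm S ℕ, MeetNode (ε n, t) →
        (∀ p, t.nodeAt (ε n) (0 :: p) =
          (solve ε e nd.1 nd.2 (.var (e (.inr nd.2)))).nodeAt (ε n) p) →
        (∀ p, t.nodeAt (ε n) (1 :: p) = (critTerm ε e n L).nodeAt (ε n) p) →
        (∀ m p, t.nodeAt (ε n) ((m + 2) :: p) = none) →
        t.nodeAt (ε n) l = some (codeSign ε d x, .var x) →
        ∃ b, GoodLeaf (codeSign ε d) (CodeLT d) (ε n) t l x 0 b := by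
      intro t hm h0 h1 h2 hl
      rcases l with _ | ⟨_ | _ | m, l⟩
      · simp only [Trm.nodeAt_nil, Option.some.injEq, Prod.mk.injEq] at hl
        rw [hl.2] at hm
        exact hm.elim
      · rw [h0] at hl
        obtain ⟨⟨l₀, hg, hu⟩, -⟩ := hpia
        obtain ⟨rfl, rfl⟩ := hu l x hl
        exact ⟨1, hg.cons h0 (Or.inr (Or.inl ⟨rfl, rfl, rfl, hm⟩))
          fun h => absurd h (meetNode_not_srr hm)⟩
      · simp only [zero_add] at hl ⊢
        rw [h1] at hl
        obtain ⟨b, hg⟩ := ih l hl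
        exact ⟨b + 1, hg.cons h1 (Or.inr (Or.inl ⟨rfl, rfl, rfl, hm⟩))
          fun h => absurd h (meetNode_not_srr hm)⟩
      · rw [h2] at hl
        simp at hl
    revert hl
    by_cases hn : ε n = true
    · simp only [critTerm, if_pos hn]
      exact key _ hn (by simp) (by simp) (by simp)
    · simp only [critTerm, if_neg hn]
      exact key _ (by simpa [MeetNode] using hn) (by simp) (by simp) (by simp)

/-- Replacing a critical leaf of a very simple Sahlqvist term extends the branch to it by that of
the replacing term. -/
theorem goodLeaf_translate_append (hN : ChainClosed ε N) {K : ℕ → Trm S ℕ} {ε' : ℕ → Bool}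
    {Ω : ℕ → ℕ → Prop} {t : Trm S.star ℕ} {σ : Bool} (ht : (σ, t) ∈ N) {l₁ l₂ : List ℕ}
    {a b n x : ℕ} (h₁ : t.nodeAt σ l₁ = some (ε n, .var n))
    (hshape : TreeShape σ t l₁ a l₁.length) (h₂ : GoodLeaf ε' Ω (ε n) (K n) l₂ x 0 b) :
    GoodLeaf ε' Ω σ (translate ε e K σ t) (l₁ ++ l₂) x a (l₁.length + b) := by
  induction l₁ generalizing σ t a with
  | nil =>
    simp only [Trm.nodeAt_nil, Option.some.injEq, Prod.mk.injEq] at h₁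
    obtain ⟨rfl, rfl⟩ := h₁
    obtain rfl : a = 0 := by have := hshape.1; simpa using this
    simpa [translate] using h₂
  | cons k l₁ ih =>
    have hlen := hshape.1
    have hroot := hshape.2 [] (σ, t) (List.nil_prefix) (by simp) rfl
    simp only [List.length_cons, List.length_nil] at hlen hroot ⊢
    have step : ∀ (τ : Bool) (c : Trm S.star ℕ),
        (∀ p, t.nodeAt σ (k :: p) = c.nodeAt τ p) →
        GoodLeaf ε' Ω τ (translate ε e K τ c) (l₁ ++ l₂) x (a - 1) (l₁.length + b) := by
      intro τ c hc
      rw [hc] at h₁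
      exact ih (hN.closed _ ht [k] (τ, c) (by rw [hc]; rfl)) h₁ (hshape.tail hc)
    cases t with
    | var y => simp at h₁
    | top => simp at h₁
    | bot => simp at h₁
    | inf c c' =>
      rcases hroot with ⟨-, h⟩ | ⟨h0, -, hm⟩ | ⟨-, h⟩
      · exact h.elim
      · have hroot' : (a - 1 = 0 ∧ a = 0 ∧ l₁.length + 1 + b = l₁.length + b + 1 ∧
            MeetNode (σ, translate ε e K σ (.inf c c'))) := ⟨by omega, by omega, by omega, hm⟩
        simp only [Trm.nodeAt_inf_cons] at h₁ step
        split_ifs at h₁ with hk0 hk1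
        · refine (step σ c (by simp [hk0])).cons (fun p => ?_) (Or.inr (Or.inl hroot'))
            fun h => absurd h (meetNode_not_srr hroot'.2.2.2)
          simp [translate, hk0]
        · refine (step σ c' (by simp [hk1])).cons (fun p => ?_) (Or.inr (Or.inl hroot'))
            fun h => absurd h (meetNode_not_srr hroot'.2.2.2)
          simp [translate, hk1]
      · exact h.elim
    | sup c c' =>
      rcases hroot with ⟨-, h⟩ | ⟨h0, -, hm⟩ | ⟨-, h⟩
      · exact h.elim
      · have hroot' : (a - 1 = 0 ∧ a = 0 ∧ l₁.length + 1 + b = l₁.length + b + 1 ∧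
            MeetNode (σ, translate ε e K σ (.sup c c'))) := ⟨by omega, by omega, by omega, hm⟩
        simp only [Trm.nodeAt_sup_cons] at h₁ step
        split_ifs at h₁ with hk0 hk1
        · refine (step σ c (by simp [hk0])).cons (fun p => ?_) (Or.inr (Or.inl hroot'))
            fun h => absurd h (meetNode_not_srr hroot'.2.2.2)
          simp [translate, hk0]
        · refine (step σ c' (by simp [hk1])).cons (fun p => ?_) (Or.inr (Or.inl hroot'))
            fun h => absurd h (meetNode_not_srr hroot'.2.2.2)
          simp [translate, hk1]
      · exact h.elim
    | op o args =>
      rcases hroot with ⟨h0, hs⟩ | ⟨-, -, h⟩ | ⟨h, -⟩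
      · cases o with
        | base h =>
          have hk : k < S.arity h := by
            by_contra hk
            rw [Trm.nodeAt_op_cons, dif_neg (show ¬ k < S.star.arity (.base h) from hk)] at h₁
            simp at h₁
          have hroot' : (a = a - 1 + 1 ∧ l₁.length + 1 + b = l₁.length + b + 1 ∧
              DefSkelNode (σ, translate ε e K σ (.op (.base h) args))) :=
            ⟨by omega, by omega, hs⟩
          refine (step (σ == S.tp h ⟨k, hk⟩) (args ⟨k, hk⟩) fun p => ?_).cons (fun p => ?_)
            (Or.inl hroot') fun h => absurd h (defSkelNode_not_srr hroot'.2.2)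
          · rw [Trm.nodeAt_op_cons, dif_pos (show k < S.star.arity (.base h) from hk)]
            rfl
          · simp [translate, hk]
        | res h i =>
          have h1 := hN.isF_eq ht
          have h2 : (S.isF h ^^ S.tp h i) = σ := hs
          rw [h2] at h1
          exact absurd h1 (by cases σ <;> decide)
      · exact h.elim
      · omega

/-- The translation of a very simple Sahlqvist tree satisfies the conditions of inductivity. -/
theorem exists_goodLeaf_translate (hN : ChainClosed ε N) (hd : ∀ n, d (e (.inl n)) = .inl n)
    (hd' : ∀ nd ∈ N, d (e (.inr nd.2)) = .inr nd.2) {L : ℕ → List (Bool × Trm S.star ℕ)}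
    (hL : ∀ n nd, nd ∈ L n ↔ nd ∈ N ∧ ResRoot nd.2 ∧ chainVar nd.2 = n) {t : Trm S.star ℕ}
    {σ : Bool} (ht : (σ, t) ∈ N)
    (hvs : ∀ l n, t.nodeAt σ l = some (ε n, .var n) → ∃ a, TreeShape σ t l a l.length)
    {l : List ℕ} {x : ℕ} (hl : (translate ε e (fun n => critTerm ε e n (L n)) σ t).nodeAt σ l =
      some (codeSign ε d x, .var x)) :
    ∃ a b, GoodLeaf (codeSign ε d) (CodeLT d) σ
      (translate ε e (fun n => critTerm ε e n (L n)) σ t) l x a b := by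
  obtain ⟨l₁, l₂, n, rfl, h1, h2⟩ := exists_of_crit_translate hN hd hd' _ ht hl
  obtain ⟨a, ha⟩ := hvs l₁ n h1
  obtain ⟨b, hb⟩ := goodLeaf_critTerm hN hd hd' n (L n) (fun nd h => (hL n nd).1 h) h2
  exact ⟨a, _, goodLeaf_translate_append (K := fun n => critTerm ε e n (L n)) hN ht h1 ha hb⟩

end TranslationShape

/-! ### From crypto-inductive to inductive inequalities -/

section Final

theorem nodeAt_finite {S : LESig.{v}} (t : Trm S ℕ) (σ : Bool) :
    {nd | ∃ p, t.nodeAt σ p = some nd}.Finite := by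
  induction t generalizing σ with
  | var y =>
    refine (Set.finite_singleton (σ, Trm.var y)).subset ?_
    rintro nd ⟨_ | ⟨k, p⟩, hp⟩ <;> simp at hp
    exact hp.symm
  | top =>
    refine (Set.finite_singleton (σ, Trm.top)).subset ?_
    rintro nd ⟨_ | ⟨k, p⟩, hp⟩ <;> simp at hp
    exact hp.symm
  | bot =>
    refine (Set.finite_singleton (σ, Trm.bot)).subset ?_
    rintro nd ⟨_ | ⟨k, p⟩, hp⟩ <;> simp at hp
    exact hp.symm
  | inf a b iha ihb =>
    refine (((iha σ).union (ihb σ)).insert (σ, Trm.inf a b)).subset ?_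
    rintro nd ⟨_ | ⟨k, p⟩, hp⟩
    · simp only [Trm.nodeAt_nil, Option.some.injEq] at hp
      exact Or.inl hp.symm
    · simp only [Trm.nodeAt_inf_cons] at hp
      split_ifs at hp
      exacts [Or.inr (Or.inl ⟨p, hp⟩), Or.inr (Or.inr ⟨p, hp⟩)]
  | sup a b iha ihb =>
    refine (((iha σ).union (ihb σ)).insert (σ, Trm.sup a b)).subset ?_
    rintro nd ⟨_ | ⟨k, p⟩, hp⟩
    · simp only [Trm.nodeAt_nil, Option.some.injEq] at hp
      exact Or.inl hp.symm
    · simp only [Trm.nodeAt_sup_cons] at hp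
      split_ifs at hp
      exacts [Or.inr (Or.inl ⟨p, hp⟩), Or.inr (Or.inr ⟨p, hp⟩)]
  | op h args ih =>
    refine ((Set.finite_iUnion fun k => ih k (σ == S.tp h k)).insert (σ, Trm.op h args)).subset ?_
    rintro nd ⟨_ | ⟨k, p⟩, hp⟩
    · simp only [Trm.nodeAt_nil, Option.some.injEq] at hp
      exact Or.inl hp.symm
    · simp only [Trm.nodeAt_op_cons] at hp
      split_ifs at hp with hk
      exact Or.inr (Set.mem_iUnion.2 ⟨⟨k, hk⟩, p, hp⟩)

theorem node_append {S : LESig.{v}} {s t : Trm S ℕ} {q : List ℕ} {nd : Bool × Trm S ℕ}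
    (h : node s t q = some nd) (p : List ℕ) : node s t (q ++ p) = nd.2.nodeAt nd.1 p := by
  rcases q with _ | ⟨_ | _ | m, q⟩
  · simp [node] at h
  · simp only [node, List.cons_append] at h ⊢
    simp [Trm.nodeAt_append, h]
  · simp only [node, List.cons_append] at h ⊢
    simp [Trm.nodeAt_append, h]
  · simp [node] at h

variable {S : LESig.{v}}

/-- The signed subterms of the trees `+s` and `-t`. -/
def signedSubterms {S : LESig.{v}} (s t : Trm S ℕ) : Set (Bool × Trm S ℕ) :=
  {nd | ∃ q, node s t q = some nd}

theorem signedSubterms_finite (s t : Trm S ℕ) : (signedSubterms s t).Finite := by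
  refine ((nodeAt_finite s true).union (nodeAt_finite t false)).subset ?_
  rintro nd ⟨_ | ⟨_ | _ | m, q⟩, hq⟩
  · simp [node] at hq
  · exact Or.inl ⟨q, hq⟩
  · exact Or.inr ⟨q, hq⟩
  · simp [node] at hq

/-- The path in a candidate for `MVTree(l)` is a chain: a new connective is residuation-conservative
in only one coordinate. -/
theorem MVCandidate.chain {ε : ℕ → Bool} {Ω : ℕ → ℕ → Prop} {s t : Trm S.star ℕ} {l r : List ℕ}
    (h : MVCandidate ε Ω s t l r) {x : ℕ} (hl : IsLeaf s t l (!(ε x)) x) (w : List ℕ) :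
    ∀ q σ T, node s t q = some (σ, T) → r <+: q → q ++ w = l → Chain ε σ T := by
  induction w with
  | nil =>
    intro q σ T hq _ hw
    rw [List.append_nil] at hw
    subst hw
    unfold IsLeaf at hl
    simp only [hq, Option.some.injEq, Prod.mk.injEq] at hl
    obtain ⟨rfl, rfl⟩ := hl
    rfl
  | cons k w ih =>
    intro q σ T hq hr hw
    obtain ⟨σ', o, args, hn, hF, hcons⟩ := h.path q k hr ⟨w, by simpa using hw⟩
    rw [hq] at hn
    simp only [Option.some.injEq, Prod.mk.injEq] at hn
    obtain ⟨rfl, rfl⟩ := hn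
    cases o with
    | base o => exact hcons.elim
    | res o i =>
      have hk : k = i.val := hcons
      subst hk
      refine ⟨hF, ih (q ++ [i.val]) _ (args i) ?_ (hr.trans ⟨[i.val], rfl⟩) (by simpa using hw)⟩
      rw [node_append hq]
      refine (Trm.nodeAt_op_fin (S := S.star) σ (.res o i) args i []).trans ?_
      have harg : StarOp.tp (.res o i) i = S.tp o i := if_pos rfl
      change some (σ == StarOp.tp (.res o i) i, args i) = _
      rw [harg]

theorem IsCryptoFor.chainClosed {meets : Bool} {ε : ℕ → Bool} {Ω : ℕ → ℕ → Prop}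
    {s t : Trm S.star ℕ} (h : IsCryptoFor meets ε Ω s t) :
    ChainClosed ε (signedSubterms s t) where
  closed := by
    rintro nd ⟨q, hq⟩ p nd' hp
    exact ⟨q ++ p, by rw [node_append hq, hp]⟩
  chain := by
    rintro ⟨σ, T⟩ ⟨q, hq⟩ hr
    obtain ⟨M, hM, hcov⟩ := h.covered
    match T, hr with
    | .op (.res o i) args, _ =>
      obtain ⟨l, ⟨x, hx⟩, hMq, w, hw⟩ := hcov q σ _ args hq (fun h => h)
      have hc := (hM l ⟨x, hx⟩).1.1
      refine ⟨hc.chain hx w q σ _ hq hMq hw, fun p y hp => ?_⟩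
      refine hc.noncrit (q ++ p) y (hMq.trans ⟨p, rfl⟩) ?_
      unfold IsLeaf
      rw [node_append hq]
      exact hp

theorem BranchShape.treeShape {S : LESig.{v}} {s t u : Trm S ℕ} {σ : Bool} {m : ℕ} {l : List ℕ}
    {a b : ℕ} (hu : ∀ p, node s t (m :: p) = u.nodeAt σ p) (h : BranchShape s t (m :: l) a b) :
    TreeShape σ u l (a - 1) (b - 1) := by
  refine ⟨Nat.sub_le_sub_right h.1 1, fun q nd hq hne hn => ?_⟩
  have := h.2 (m :: q) nd (List.cons_prefix_cons.2 ⟨rfl, hq⟩) (by simpa using hne)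
    (by rw [hu]; exact hn)
  simp only [List.length_cons] at this
  rcases this with ⟨h1, h3⟩ | ⟨h1, h2, h3⟩ | ⟨h1, h3⟩
  · exact Or.inl ⟨by omega, h3⟩
  · exact Or.inr (Or.inl ⟨by omega, by omega, h3⟩)
  · exact Or.inr (Or.inr ⟨by omega, h3⟩)

theorem GoodLeaf.branch {S : LESig.{v}} {s t u : Trm S ℕ} {σ : Bool} {m : ℕ} {l : List ℕ}
    {ε : ℕ → Bool} {Ω : ℕ → ℕ → Prop} {x a b : ℕ}
    (hu : ∀ p, node s t (m :: p) = u.nodeAt σ p) (h : GoodLeaf ε Ω σ u l x a b) :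
    BranchShape s t (m :: l) (a + 1) (b + 1) ∧
      ∀ q nd, q <+: m :: l → q ≠ m :: l → node s t q = some nd → SRRNode nd →
        (∀ l' x', q <+: l' → IsLeaf s t l' (ε x') x' → l' = m :: l) ∧
        (∀ l' σ y, q <+: l' → IsLeaf s t l' σ y → y ≠ x → Ω y x) := by
  obtain ⟨⟨hab, hs⟩, hg⟩ := h
  refine ⟨⟨by omega, fun q nd hq hne hn => ?_⟩, fun q nd hq hne hn hsrr => ?_⟩
  · rcases q with _ | ⟨m', q⟩
    · simp [node] at hn
    rw [List.cons_prefix_cons] at hq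
    obtain ⟨rfl, hq⟩ := hq
    rw [hu] at hn
    have := hs q nd hq (fun e => hne (by rw [e])) hn
    simp only [List.length_cons]
    rcases this with ⟨h1, h3⟩ | ⟨h1, h2, h3⟩ | ⟨h1, h3⟩
    · exact Or.inl ⟨by omega, h3⟩
    · exact Or.inr (Or.inl ⟨by omega, by omega, h3⟩)
    · exact Or.inr (Or.inr ⟨by omega, h3⟩)
  · rcases q with _ | ⟨m', q⟩
    · simp [node] at hn
    rw [List.cons_prefix_cons] at hq
    obtain ⟨rfl, hq⟩ := hq
    rw [hu] at hn
    have := hg q nd hq (fun e => hne (by rw [e])) hn hsrr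
    constructor
    · intro l' x' hl' hx'
      obtain ⟨w, rfl⟩ := hl'
      unfold IsLeaf at hx'
      rw [List.cons_append, hu] at hx'
      rw [List.cons_append, this.1 _ x' ⟨w, rfl⟩ hx']
    · intro l' τ y hl' hy
      obtain ⟨w, rfl⟩ := hl'
      unfold IsLeaf at hy
      rw [List.cons_append, hu] at hy
      exact this.2 _ τ y ⟨w, rfl⟩ hy

/-- Every inequality with the conditions of crypto-inductivity is equivalent to an inductive
inequality of the original language, up to the elimination of uniform variables. -/
theorem IsCryptoFor.exists_inductive {meets : Bool} {ε : ℕ → Bool} {Ω : ℕ → ℕ → Prop}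
    {s t : Trm S.star ℕ} (h : IsCryptoFor meets ε Ω s t) :
    ∃ s' t' : Trm S ℕ, (∃ ε' Ω', IsStrict Ω' ∧ IsInductiveFor ε' Ω' s' t') ∧
      ∀ A : PerfectLE.{u} S, A.ValidStar s t ↔ A.Valid s' t' := by
  classical
  have hN := h.chainClosed
  have hfin := signedSubterms_finite s t
  -- an injective coding of the old variables and of the finitely many chains by numbers
  have hcount : (Set.range Sum.inl ∪ (fun nd : Bool × Trm S.star ℕ => Sum.inr nd.2) ''
      signedSubterms s t : Set (ℕ ⊕ Trm S.star ℕ)).Countable :=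
    (Set.countable_range _).union (hfin.image _).countable
  obtain ⟨e, he⟩ := Set.countable_iff_exists_injOn.1 hcount
  have hinv := he.leftInvOn_invFunOn
  have hd : ∀ n, Function.invFunOn e _ (e (.inl n)) = .inl n := fun n => hinv (Or.inl ⟨n, rfl⟩)
  have hd' : ∀ nd ∈ signedSubterms s t, Function.invFunOn e _ (e (.inr nd.2)) = .inr nd.2 :=
    fun nd hnd => hinv (Or.inr ⟨nd, hnd, rfl⟩)
  set d := Function.invFunOn e (Set.range Sum.inl ∪ (fun nd : Bool × Trm S.star ℕ =>
    Sum.inr nd.2) '' signedSubterms s t : Set (ℕ ⊕ Trm S.star ℕ))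
  let L : ℕ → List (Bool × Trm S.star ℕ) := fun n =>
    hfin.toFinset.toList.filter fun nd => ResRoot nd.2 ∧ chainVar nd.2 = n
  have hL : ∀ n nd, nd ∈ L n ↔ nd ∈ signedSubterms s t ∧ ResRoot nd.2 ∧ chainVar nd.2 = n := by
    intro n nd
    simp [L]
  have hs : (true, s) ∈ signedSubterms s t := ⟨[0], rfl⟩
  have ht : (false, t) ∈ signedSubterms s t := ⟨[1], rfl⟩
  have hvs : ∀ (u : Trm S.star ℕ) (σ : Bool) (m : ℕ),
      (∀ p, node s t (m :: p) = u.nodeAt σ p) →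
      ∀ l n, u.nodeAt σ l = some (ε n, .var n) → ∃ a, TreeShape σ u l a l.length := by
    intro u σ m hu l n hl
    obtain ⟨a, ha, -⟩ := h.verySimple (m :: l) n (by unfold IsLeaf; rw [hu]; exact hl)
    exact ⟨a - 1, ha.treeShape hu⟩
  have hgood : ∀ l x, IsLeaf (translate ε e (fun n => critTerm ε e n (L n)) true s)
      (translate ε e (fun n => critTerm ε e n (L n)) false t) l (codeSign ε d x) x →
      ∃ (σ : Bool) (u : Trm S ℕ) (m : ℕ) (l' : List ℕ) (a b : ℕ), l = m :: l' ∧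
        (∀ p, node (translate ε e (fun n => critTerm ε e n (L n)) true s)
          (translate ε e (fun n => critTerm ε e n (L n)) false t) (m :: p) = u.nodeAt σ p) ∧
        GoodLeaf (codeSign ε d) (CodeLT d) σ u l' x a b := by
    intro l x hl
    rcases l with _ | ⟨_ | _ | m, l⟩
    · simp [IsLeaf, node] at hl
    · obtain ⟨a, b, hg⟩ := exists_goodLeaf_translate hN hd hd' hL hs
        (hvs s true 0 fun _ => rfl) hl
      exact ⟨true, _, 0, l, a, b, rfl, fun _ => rfl, hg⟩
    · obtain ⟨a, b, hg⟩ := exists_goodLeaf_translate hN hd hd' hL ht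
        (hvs t false 1 fun _ => rfl) hl
      exact ⟨false, _, 1, l, a, b, rfl, fun _ => rfl, hg⟩
    · simp [IsLeaf, node] at hl
  refine ⟨translate ε e (fun n => critTerm ε e n (L n)) true s,
    translate ε e (fun n => critTerm ε e n (L n)) false t,
    ⟨codeSign ε d, CodeLT d, isStrict_codeLT d, fun l x hl => ?_, fun l x hl => ?_⟩,
    fun A => validStar_iff_valid_translate A hN hd hd' L hL hs ht⟩
  · obtain ⟨σ, u, m, l', a, b, rfl, hu, hg⟩ := hgood l x hl
    exact ⟨a + 1, b + 1, (hg.branch hu).1⟩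
  · obtain ⟨σ, u, m, l', a, b, rfl, hu, hg⟩ := hgood l x hl
    exact (hg.branch hu).2

end Final

end InvCorr

theorem mainTheorem2 (S : InvCorr.LESig.{v}) (meets : Bool) (χ : InvCorr.FO S)
    (hχ : InvCorr.IsInverseCorrespondent meets χ) :
    (∃ s t : InvCorr.Trm S.star ℕ, InvCorr.IsCryptoInductive meets s t ∧
      ∀ A : InvCorr.PerfectLE.{u, v} S, A.Models χ ↔ A.ValidStar s t) ∧
    (∃ s t : InvCorr.Trm S ℕ, InvCorr.IsInductive s t ∧
      ∀ A : InvCorr.PerfectLE.{u, v} S, A.Models χ ↔ A.Valid s t) := by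
  obtain ⟨D, hD, ε, Ω, h⟩ := hχ
  have hmodels : ∀ A : InvCorr.PerfectLE.{u, v} S, A.Models χ ↔ A.ValidStar D.lhs D.rhs := by
    intro A
    rw [← D.truth_iff_validStar]
    rcases hD with rfl | rfl
    · exact D.models_formula_iff A
    · exact D.models_formulaImp_iff A
  constructor
  · exact ⟨_, _, ⟨⟨ε, Ω, h.elimUniform D.not_defPIANode_above_uniform⟩,
      InvCorr.noUniform_elimUniform⟩,
      fun A => (hmodels A).trans (InvCorr.valid_elimUniform_iff A.residuated_opStar)⟩
  · obtain ⟨s', t', ⟨ε', Ω', hΩ, hind⟩, hequiv⟩ := h.exists_inductive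
    exact ⟨_, _, ⟨⟨ε', Ω', hΩ, hind.elimUniform⟩, InvCorr.noUniform_elimUniform⟩,
      fun A => ((hmodels A).trans (hequiv A)).trans
        (InvCorr.valid_elimUniform_iff A.residuated_op)⟩
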